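/- Fix an integer $k\ge 1$ and a commutative ring $R$ of coefficients. Let $W$ be the affine symmetric group, generated by the permutations $s_0,\dots,s_k$ of $\mathbb Z$, where $t_{i,j}$ (for $i\not\equiv j \bmod k+1$) interchanges $i+q(k+1)$ and $j+q(k+1)$ for all $q\in\mathbb Z$ and fixes all other integers, and $s_i=t_{i,i+1}$. Let $\ell$ be the length function of $W$ with respect to these generators. Let $\mathbb A$ be the affine nilCoxeter algebra of $W$ over $R$, with basis $(\mathbf u_w)_{w\in W}$ and product $\mathbf u_v\mathbf u_w=\mathbf u_{vw}$ if $\ell(vw)=\ell(v)+\ell(w)$, and $\mathbf u_v\mathbf u_w=0$ otherwise. Write $\mathbf u_i=\mathbf u_{s_i}$. Let $\mathcal G^{\downarrow}$ be the labelled directed multigraph with vertex set $W$ that has, for every $x,y\in W$ and every pair of integers $i\le 0<j$ with $i\not\equiv j \bmod k+1$, $y\,t_{i,j}=x$ and $\ell(x)=\ell(y)+1$, one arrow from $x$ to $y$ with label $y(j)$. The ascent composition of a sequence of integers $\ell_1,\dots,\ell_m$ is the composition of $m$ whose parts are the lengths of the pieces obtained by cutting the sequence between $\ell_a$ and $\ell_{a+1}$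 whenever $\ell_a<\ell_{a+1}$. For a composition $J$ of $m\ge 0$, let $D_J:\mathbb A\to\mathbb A$ be the linear map that sends $\mathbf u_w$ to $\sum \mathbf u_{w_m}$, where the sum is over all paths $w\to w_1\to\cdots\to w_m$ of length $m$ in $\mathcal G^{\downarrow}$ whose sequence of labels has ascent composition $J$. In particular, $D_{1^n}$ (that is, $J=(1,\dots,1)$ with $n$ parts) sums over the paths of length $n$ with strictly increasing labels $\ell_1<\cdots<\ell_n$. A cell in row $i$ and column $j$ (rows numbered from top to bottom) has residue $(j-i) \bmod (k+1)$. For a finite set $\mathcal D$ of cells, let $\mathbf u_{\mathcal D}\in\mathbb A$ be the product of the generators $\mathbf u_r$, where $r$ runs over the residues of the cells of $\mathcal D$, read row by row from the bottom row to the top row, and from right to left in each row. **Theorem.** Let $c\in\{0,1,\dots,k\}$, let $\lambda$ be a partition whose diagram is contained in the rectangle $(c^{k+1-c})$ with $k+1-c$ rows and $c$ columns, and let $n\ge 0$. Then $$D_{1^n}(\mathbf u_\lambda)=\sum_{X}\mathbf u_{\lambda\setminus X},$$ where $X$ ranges over all sets of $n$ cells of $\lambda$ such that * (C2) whenever $(i,j),(i',j')\in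 X$ satisfy $i>i'$ and $j<j'$, the cell $(i,j')$ does not belong to $\lambda$; * no two distinct cells of $X$ lie in the same row. -/

import Mathlib

namespace DownOp

/-! ### The affine symmetric group -/

/-- The map underlying `t_{a,b}`: it interchanges `a + qN` and `b + qN` for every integer `q`,
and fixes the integers that are congruent modulo `N` neither to `a` nor to `b`. -/
def reflFun (N a b m : ℤ) : ℤ :=
  if m ≡ a [ZMOD N] then m + (b - a) else if m ≡ b [ZMOD N] then m - (b - a) else m

theorem reflFun_involutive (N a b : ℤ) (h : ¬ a ≡ b [ZMOD N]) :
    Function.Involutive (reflFun N a b) := by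
  intro m
  unfold reflFun
  by_cases h1 : m ≡ a [ZMOD N]
  · have h2 : m + (b - a) ≡ b [ZMOD N] := by
      have := h1.add_right (b - a)
      simpa using this
    have h3 : ¬ m + (b - a) ≡ a [ZMOD N] := fun h3 => h (h3.symm.trans h2)
    simp [h1, h2, h3]
  · by_cases h2 : m ≡ b [ZMOD N]
    · have h3 : m - (b - a) ≡ a [ZMOD N] := by
        have := h2.sub_right (b - a)
        simpa using this
      simp [h1, h2, h3]
    · simp [h1, h2]

/-- The permutation `t_{a,b}` of `ℤ`, with period `k + 1`. It is meant for `a`, `b` that are not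
congruent modulo `k + 1` (otherwise it is the identity by convention). -/
def refl (k : ℕ) (a b : ℤ) : Equiv.Perm ℤ :=
  if h : a ≡ b [ZMOD ((k + 1 : ℕ) : ℤ)] then 1
  else (reflFun_involutive _ a b h).toPerm

/-- The simple generator `s_i = t_{i,i+1}`, with `i` an integer modulo `k + 1`. -/
def simplePerm (k : ℕ) (i : ZMod (k + 1)) : Equiv.Perm ℤ :=
  refl k ((i.val : ℕ) : ℤ) (((i.val : ℕ) : ℤ) + 1)

/-- The affine symmetric group `W`, with simple generators `s_0, …, s_k`, realised as a group of
permutations of `ℤ`. -/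
def affineSym (k : ℕ) : Subgroup (Equiv.Perm ℤ) :=
  Subgroup.closure (Set.range (simplePerm k))

/-- `s_i` as an element of `W`. -/
def simple (k : ℕ) (i : ZMod (k + 1)) : affineSym k :=
  ⟨simplePerm k i, Subgroup.subset_closure ⟨i, rfl⟩⟩

/-- The product `s_{i_1} ⋯ s_{i_l}` of a word `[i_1, …, i_l]`. -/
def wordProd (k : ℕ) (l : List (ZMod (k + 1))) : affineSym k :=
  (l.map (simple k)).prod

/-- The Coxeter length: the least length of a word in the simple generators with product `w`. -/
noncomputable def len {k : ℕ} (w : affineSym k) : ℕ :=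
  sInf {n : ℕ | ∃ l : List (ZMod (k + 1)), l.length = n ∧ wordProd k l = w}

theorem simplePerm_mul_self (k : ℕ) (i : ZMod (k + 1)) :
    simplePerm k i * simplePerm k i = 1 := by
  unfold simplePerm refl
  split_ifs with h
  · simp
  · ext m
    exact reflFun_involutive _ _ _ h m

theorem wordProd_append (k : ℕ) (l l' : List (ZMod (k + 1))) :
    wordProd k (l ++ l') = wordProd k l * wordProd k l' := by
  simp [wordProd]

theorem exists_word {k : ℕ} (w : affineSym k) :
    ∃ l : List (ZMod (k + 1)), wordProd k l = w := by
  obtain ⟨w, hw⟩ := w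
  suffices h : ∃ l : List (ZMod (k + 1)), ((wordProd k l : affineSym k) : Equiv.Perm ℤ) = w by
    obtain ⟨l, hl⟩ := h
    exact ⟨l, Subtype.ext hl⟩
  have simple_inv : ∀ i, (simplePerm k i)⁻¹ = simplePerm k i := fun i =>
    inv_eq_of_mul_eq_one_left (simplePerm_mul_self k i)
  refine Subgroup.closure_induction (G := Equiv.Perm ℤ)
    (p := fun w _ => ∃ l : List (ZMod (k + 1)), ((wordProd k l : affineSym k) : Equiv.Perm ℤ) = w)
    ?_ ?_ ?_ ?_ hw
  · rintro _ ⟨i, rfl⟩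
    exact ⟨[i], by simp [wordProd, simple]⟩
  · exact ⟨[], by simp [wordProd]⟩
  · rintro x y _ _ ⟨l, rfl⟩ ⟨l', rfl⟩
    exact ⟨l ++ l', by rw [wordProd_append]; rfl⟩
  · rintro x _ ⟨l, rfl⟩
    refine ⟨l.reverse, ?_⟩
    induction l with
    | nil => simp [wordProd]
    | cons i l ih =>
      have h1 : wordProd k (i :: l) = simple k i * wordProd k l := by simp [wordProd]
      have h2 : wordProd k [i] = simple k i := by simp [wordProd]
      rw [List.reverse_cons, wordProd_append, h1, h2, Subgroup.coe_mul, Subgroup.coe_mul, ih (SetLike.coe_mem _),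
        mul_inv_rev]
      congr 1
      exact (simple_inv i).symm

theorem exists_reduced_word {k : ℕ} (w : affineSym k) :
    ∃ l : List (ZMod (k + 1)), l.length = len w ∧ wordProd k l = w := by
  obtain ⟨l, hl⟩ := exists_word w
  exact Nat.sInf_mem (s := {n : ℕ | ∃ l : List (ZMod (k + 1)), l.length = n ∧ wordProd k l = w})
    ⟨l.length, l, rfl, hl⟩

theorem len_wordProd_le {k : ℕ} (l : List (ZMod (k + 1))) : len (wordProd k l) ≤ l.length :=
  Nat.sInf_le ⟨l, rfl, rfl⟩

theorem len_one (k : ℕ) : len (1 : affineSym k) = 0 :=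
  Nat.le_zero.mp (len_wordProd_le (k := k) [])

theorem len_mul_le {k : ℕ} (v w : affineSym k) : len (v * w) ≤ len v + len w := by
  obtain ⟨l, hl, rfl⟩ := exists_reduced_word v
  obtain ⟨l', hl', rfl⟩ := exists_reduced_word w
  rw [← hl, ← hl', ← wordProd_append, ← List.length_append]
  exact len_wordProd_le _

/-! ### The affine nilCoxeter algebra -/

/-- The affine nilCoxeter algebra `𝔸` over `R`, as the free module on the affine symmetric group.
Its multiplication is given below on the basis by `u_v u_w = u_{vw}` if `ℓ(vw) = ℓ(v) + ℓ(w)`, and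
`u_v u_w = 0` otherwise. -/
def NilCoxeter (R : Type*) [CommRing R] (k : ℕ) : Type _ := affineSym k →₀ R

namespace NilCoxeter

variable (R : Type*) [CommRing R] (k : ℕ)

noncomputable instance : AddCommGroup (NilCoxeter R k) :=
  inferInstanceAs (AddCommGroup (affineSym k →₀ R))

noncomputable instance : Module R (NilCoxeter R k) :=
  inferInstanceAs (Module R (affineSym k →₀ R))

variable {k} in
/-- The basis element `u_w`. -/
noncomputable def u (w : affineSym k) : NilCoxeter R k := Finsupp.single w (1 : R)

variable {k} in
/-- The linear map on `𝔸` with prescribed values on the basis `u_w`. -/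
noncomputable def extend {M : Type*} [AddCommGroup M] [Module R M] (f : affineSym k → M) :
    NilCoxeter R k →ₗ[R] M :=
  Finsupp.linearCombination R f

variable {R k}

theorem extend_u {M : Type*} [AddCommGroup M] [Module R M] (f : affineSym k → M)
    (w : affineSym k) : extend R f (u R w) = f w := by
  unfold extend u
  exact (Finsupp.linearCombination_single R (1 : R) w).trans (one_smul R (f w))

theorem hom_ext {M : Type*} [AddCommGroup M] [Module R M] {f g : NilCoxeter R k →ₗ[R] M}
    (h : ∀ w, f (u R w) = g (u R w)) : f = g :=
  Finsupp.lhom_ext' fun w => LinearMap.ext_ring (h w)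

/-- The product of two basis elements. -/
noncomputable def uMul (v w : affineSym k) : NilCoxeter R k :=
  if len (v * w) = len v + len w then u R (v * w) else 0

variable (R k) in
/-- The multiplication of `𝔸`, as a bilinear map. -/
noncomputable def mulHom : NilCoxeter R k →ₗ[R] NilCoxeter R k →ₗ[R] NilCoxeter R k :=
  extend R fun v => extend R fun w => uMul v w

theorem mulHom_u_u (v w : affineSym k) : mulHom R k (u R v) (u R w) = uMul v w := by
  simp [mulHom, extend_u]

theorem mulHom_assoc (a b c : NilCoxeter R k) :
    mulHom R k (mulHom R k a b) c = mulHom R k a (mulHom R k b c) := by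
  have key : ∀ x y z : affineSym k,
      mulHom R k (mulHom R k (u R x) (u R y)) (u R z) =
        mulHom R k (u R x) (mulHom R k (u R y) (u R z)) := by
    intro x y z
    have h1 := len_mul_le x y
    have h2 := len_mul_le y z
    have h3 := len_mul_le (x * y) z
    have h4 := len_mul_le x (y * z)
    rw [mulHom_u_u, mulHom_u_u]
    have e : x * y * z = x * (y * z) := mul_assoc x y z
    rw [e] at h3
    by_cases hxy : len (x * y) = len x + len y
    · rw [uMul, if_pos hxy, mulHom_u_u]
      by_cases hyz : len (y * z) = len y + len z
      · rw [uMul, uMul, if_pos hyz, mulHom_u_u, uMul, e, hxy, hyz, add_assoc]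
      · rw [uMul, uMul, if_neg hyz, map_zero, if_neg]
        rw [e]; omega
    · rw [uMul, if_neg hxy, map_zero, LinearMap.zero_apply]
      by_cases hyz : len (y * z) = len y + len z
      · rw [uMul, if_pos hyz, mulHom_u_u, uMul, if_neg]
        omega
      · rw [uMul, if_neg hyz, map_zero]
  have h : (mulHom R k).compr₂ (mulHom R k) =
      ((LinearMap.llcomp R (NilCoxeter R k) (NilCoxeter R k) (NilCoxeter R k)).flip.comp
        (mulHom R k)).flip.comp (mulHom R k) := by
    refine hom_ext fun x => hom_ext fun y => hom_ext fun z => ?_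
    simpa using key x y z
  have h' := LinearMap.congr_fun (LinearMap.congr_fun (LinearMap.congr_fun h a) b) c
  simpa using h'

theorem one_mulHom (a : NilCoxeter R k) : mulHom R k (u R 1) a = a := by
  have h : mulHom R k (u R 1) = LinearMap.id := hom_ext fun w => by
    rw [mulHom_u_u, uMul, if_pos (by simp [len_one]), one_mul, LinearMap.id_apply]
  rw [h, LinearMap.id_apply]

theorem mulHom_one (a : NilCoxeter R k) : mulHom R k a (u R 1) = a := by
  have h : (mulHom R k).flip (u R 1) = LinearMap.id := hom_ext fun w => by
    rw [LinearMap.flip_apply, mulHom_u_u, uMul, if_pos (by simp [len_one]), mul_one,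
      LinearMap.id_apply]
  exact LinearMap.congr_fun h a

noncomputable instance : Ring (NilCoxeter R k) :=
  { (inferInstance : AddCommGroup (NilCoxeter R k)) with
    mul := fun a b => mulHom R k a b
    one := u R 1
    mul_assoc := mulHom_assoc
    one_mul := one_mulHom
    mul_one := mulHom_one
    left_distrib := fun a b c => map_add (mulHom R k a) b c
    right_distrib := fun a b c => LinearMap.map_add₂ (mulHom R k) a b c
    zero_mul := fun a => LinearMap.map_zero₂ (mulHom R k) a
    mul_zero := fun a => map_zero (mulHom R k a) }

theorem u_mul_u (v w : affineSym k) :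
    u R v * u R w = if len (v * w) = len v + len w then u R (v * w) else 0 :=
  mulHom_u_u v w

end NilCoxeter

open NilCoxeter in
/-- The generator `u_i = u_{s_i}` of `𝔸`. -/
noncomputable def gen (R : Type*) [CommRing R] {k : ℕ} (i : ZMod (k + 1)) : NilCoxeter R k :=
  u R (simple k i)

/-! ### The marked strong order graph and its paths -/

/-- The data of an arrow of the marked strong order graph out of a given vertex: its target `y`,
and the pair `(i, j)`. -/
structure Arrow (k : ℕ) where
  tgt : affineSym k
  i : ℤ
  j : ℤ

/-- The label `y(j)` of an arrow. -/
def Arrow.label {k : ℕ} (e : Arrow k) : ℤ := (e.tgt : Equiv.Perm ℤ) e.j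

/-- `e` is an arrow out of `x`: for every instance of `i ≤ 0 < j` such that `y t_{i,j} = x` and
`ℓ(x) = ℓ(y) + 1` there is one arrow from `x` to `y`. -/
structure Arrow.IsFrom {k : ℕ} (x : affineSym k) (e : Arrow k) : Prop where
  i_nonpos : e.i ≤ 0
  j_pos : 0 < e.j
  not_modEq : ¬ e.i ≡ e.j [ZMOD ((k + 1 : ℕ) : ℤ)]
  mul_refl : (e.tgt : Equiv.Perm ℤ) * refl k e.i e.j = x
  len_eq : len x = len e.tgt + 1

/-- The list of arrows `p` is a path starting at `w`. -/
def IsPath {k : ℕ} : affineSym k → List (Arrow k) → Prop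
  | _, [] => True
  | w, e :: p => e.IsFrom w ∧ IsPath e.tgt p

/-- The last vertex of a path starting at `w`. -/
def pathEnd {k : ℕ} : affineSym k → List (Arrow k) → affineSym k
  | w, [] => w
  | _, e :: p => pathEnd e.tgt p

/-- The ascent composition of a sequence of integers: cut the sequence at each of its ascents
`ℓ_a < ℓ_{a+1}`, and list the lengths of the pieces. -/
def ascComp : List ℤ → List ℕ
  | [] => []
  | [_] => [1]
  | a :: b :: l =>
    if a < b then 1 :: ascComp (b :: l)
    else
      match ascComp (b :: l) with
      | [] => [1]
      | c :: cs => (c + 1) :: cs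

/-- The paths of length `m` starting at `w` whose sequence of labels has ascent composition `J`. -/
def pathsWith {k m : ℕ} (J : Composition m) (w : affineSym k) : Set (List (Arrow k)) :=
  {p | IsPath w p ∧ p.length = m ∧ ascComp (p.map Arrow.label) = J.blocks}

theorem simplePerm_displacement (k : ℕ) (i : ZMod (k + 1)) (m : ℤ) :
    |simplePerm k i m - m| ≤ 1 := by
  unfold simplePerm refl
  split_ifs with h
  · simp
  · change |reflFun _ _ _ m - m| ≤ 1
    unfold reflFun
    split_ifs <;> simp

theorem exists_displacement {k : ℕ} (w : affineSym k) :
    ∃ M : ℤ, ∀ m : ℤ, |(w : Equiv.Perm ℤ) m - m| ≤ M := by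
  obtain ⟨l, rfl⟩ := exists_word w
  induction l with
  | nil => exact ⟨0, fun m => by simp [wordProd]⟩
  | cons i l ih =>
    obtain ⟨M, hM⟩ := ih
    refine ⟨1 + M, fun m => ?_⟩
    have h1 : wordProd k (i :: l) = simple k i * wordProd k l := by simp [wordProd]
    have h2 := simplePerm_displacement k i ((wordProd k l : Equiv.Perm ℤ) m)
    have h3 := hM m
    rw [h1]
    change |simplePerm k i ((wordProd k l : Equiv.Perm ℤ) m) - m| ≤ 1 + M
    exact (abs_sub_le _ _ _).trans (add_le_add h2 h3)

theorem finite_len_eq (k n : ℕ) : {w : affineSym k | len w = n}.Finite := by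
  have hf : {l : List (ZMod (k + 1)) | l.length = n}.Finite :=
    List.finite_length_eq (ZMod (k + 1)) n
  refine (hf.image (wordProd k)).subset ?_
  intro w hw
  obtain ⟨l, hl, h⟩ := exists_reduced_word w
  exact ⟨l, hl.trans hw, h⟩

theorem refl_apply_left (k : ℕ) (a b : ℤ) (h : ¬ a ≡ b [ZMOD ((k + 1 : ℕ) : ℤ)]) :
    refl k a b a = b := by
  rw [refl, dif_neg h]
  change reflFun _ a b a = b
  simp [reflFun]

theorem finite_arrows {k : ℕ} (x : affineSym k) : {e : Arrow k | e.IsFrom x}.Finite := by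
  have hx : ∀ y : affineSym k, {e : Arrow k | e.IsFrom x ∧ e.tgt = y}.Finite := by
    intro y
    obtain ⟨M, hM⟩ := exists_displacement (y⁻¹ * x)
    refine (((Set.finite_Icc (-M) M).prod (Set.finite_Icc (-M) M)).image
      fun q => (⟨y, q.1, q.2⟩ : Arrow k)).subset ?_
    rintro ⟨y', i, j⟩ ⟨h, rfl⟩
    have hi := h.i_nonpos
    have hj := h.j_pos
    have h2 : ((y'⁻¹ * x : affineSym k) : Equiv.Perm ℤ) i = j := by
      have h3 : ((y'⁻¹ * x : affineSym k) : Equiv.Perm ℤ) = refl k i j := by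
        rw [Subgroup.coe_mul, Subgroup.coe_inv]
        exact inv_mul_eq_of_eq_mul h.mul_refl.symm
      rw [h3]
      exact refl_apply_left k i j h.not_modEq
    have h4 := hM i
    rw [h2] at h4
    have h5 := (abs_le.mp h4).2
    simp only at hi hj
    refine ⟨(i, j), ⟨⟨?_, ?_⟩, ⟨?_, ?_⟩⟩, rfl⟩ <;> simp only <;> omega
  refine ((finite_len_eq k (len x - 1)).biUnion fun y _ => hx y).subset ?_
  intro e he
  simp only [Set.mem_iUnion]
  refine ⟨e.tgt, ?_, he, rfl⟩
  have := he.len_eq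
  simp only [Set.mem_ofPred_eq]
  omega

theorem finite_paths {k : ℕ} (n : ℕ) (w : affineSym k) :
    {p : List (Arrow k) | IsPath w p ∧ p.length = n}.Finite := by
  induction n generalizing w with
  | zero =>
    refine (Set.finite_singleton []).subset ?_
    rintro p ⟨-, hp⟩
    exact List.length_eq_zero_iff.mp hp
  | succ n ih =>
    refine ((finite_arrows w).biUnion fun e _ => (ih e.tgt).image (List.cons e)).subset ?_
    rintro p ⟨hp, hl⟩
    cases p with
    | nil => simp at hl
    | cons e p =>
      simp only [Set.mem_iUnion]
      exact ⟨e, hp.1, p, ⟨hp.2, by simpa using hl⟩, rfl⟩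

theorem finite_pathsWith {k m : ℕ} (J : Composition m) (w : affineSym k) :
    (pathsWith J w).Finite :=
  (finite_paths m w).subset fun _ hp => ⟨hp.1, hp.2.1⟩

open NilCoxeter in
/-- The down operator `D_J : 𝔸 → 𝔸`: the linear map that sends `u_w` to the sum of the `u_v`, where
`v` is the end of the path, over all paths that start at `w` and whose sequence of labels has ascent
composition `J`. -/
noncomputable def down (R : Type*) [CommRing R] {k m : ℕ} (J : Composition m) :
    NilCoxeter R k →ₗ[R] NilCoxeter R k :=
  extend R fun w => ∑ p ∈ (finite_pathsWith J w).toFinset, u R (pathEnd w p)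

/-! ### Diagrams -/

/-- The `k`-rectangle `(c^{k+1-c})`, with `k + 1 - c` rows and `c` columns. -/
def kRect (k c : ℕ) : YoungDiagram where
  cells := Finset.range (k + 1 - c) ×ˢ Finset.range c
  isLowerSet := by
    rintro ⟨a, b⟩ ⟨a', b'⟩ ⟨h1, h2⟩ h
    simp only [Finset.coe_product, Finset.coe_range, Set.mem_prod, Set.mem_Iio] at h h1 h2 ⊢
    exact ⟨h1.trans_lt h.1, h2.trans_lt h.2⟩

/-- The residue of the cell in row `x.1` and column `x.2`: column minus row, modulo `k + 1`.
(Rows and columns are both numbered from `0`, which does not change the difference.) -/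
def residue (k : ℕ) (x : ℕ × ℕ) : ZMod (k + 1) := (((x.2 : ℤ) - (x.1 : ℤ) : ℤ) : ZMod (k + 1))

/-- The cells of a finite diagram in reading order: the rows from bottom to top, and each row from
right to left. This is the decreasing lexicographic order on pairs (row, column). -/
def reading (D : Finset (ℕ × ℕ)) : List (ℕ × ℕ) :=
  ((D.map toLex.toEmbedding).sort (· ≥ ·)).map ofLex

/-- The element `u_D` of `𝔸`: the product of the generators `u_i`, where `i` runs over the residues
of the cells of the diagram `D` in reading order. -/
noncomputable def uDiag (R : Type*) [CommRing R] (k : ℕ) (D : Finset (ℕ × ℕ)) : NilCoxeter R k :=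
  ((reading D).map fun x => gen R (residue k x)).prod

/-- Condition (C2): whenever `x ∈ X` lies strictly below and strictly to the left of `y ∈ X`, the
cell in the row of `x` and the column of `y` is not in `lam`. -/
abbrev CondC2 (lam : YoungDiagram) (X : Finset (ℕ × ℕ)) : Prop :=
  ∀ x ∈ X, ∀ y ∈ X, y.1 < x.1 → x.2 < y.2 → (x.1, y.2) ∉ lam

/-- No two distinct cells of `X` lie in the same row. -/
abbrev DistinctRows (X : Finset (ℕ × ℕ)) : Prop :=
  ∀ x ∈ X, ∀ y ∈ X, x.1 = y.1 → x = y

end DownOp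

/-!
Let `w` be the permutation of `lam`. Attach the position `-r` to row `r` and the position `s + 1` to
column `s` (rows and columns numbered from `0`). All these positions lie in the window
`{c - k, …, c}`, which `w` preserves, and `w` is explicit there: `w(-r) = lam.rowLen r - r` and
`w(s + 1) = s + 1 - lam.colLen s` (`cellProd_reading`). Thus `w` is increasing on the positions `≤ 0`
and on the positions `> 0` of the window, and its inversions there are the pairs `(-r, s + 1)` with
`(r, s)` a cell of `lam`. Moreover, deleting the letters of a set `X` of cells from the word of `lam`
amounts to multiplying `w` on the right by the reflections `t_{-r,s+1}`, for `(r, s)` in `X` in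
reading order.

On the other side, consider a path from `w` with increasing labels. An arrow out of `x` exchanges
the values of an inversion `(i, j)` with `i ≤ 0 < j`; as `x` preserves the window, `i` and `j` belong
to it, so `i = -r` and `j = s + 1`. The label of the arrow is the value at `-r`, and the values at
nonpositive positions only go down, hence the labels increase only if each row lies strictly above
the previous ones, where the initial values are still in place. The pair `(r, s)` is a cell of `lam`,
and the condition that the length drops by one only says that no position between `-r` and `s + 1`
carries an intermediate value. The columns already used carry row values, and comparing them with the
initial values of the other columns turns this condition into (C2) for the new cell
(`PathState.not_between`, `PathState.condC2_insert`). So the paths correspond to the sets `X`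
(`PathState.insert_cell`, `PathState.exists_cell`), and the path of `X` ends at the permutation of
`lam \ X`, whose word is reduced since the length drops by one at each step.

Two facts on lengths are needed. By the strong exchange property (`strong_exchange`), exchanging the
values of an inversion shortens a permutation, and an intermediate value makes the length drop by at
least three. Conversely, the number of inversions in the window bounds the length from below
(`card_windowInv_le_len`), with equality along the paths.
-/

namespace DownOp

/-! ### Reflections and periodicity -/

theorem refl_of_modEq {k : ℕ} {a b : ℤ} (h : a ≡ b [ZMOD ((k + 1 : ℕ) : ℤ)]) :
    refl k a b = 1 := dif_pos h

theorem refl_apply {k : ℕ} {a b : ℤ} (h : ¬ a ≡ b [ZMOD ((k + 1 : ℕ) : ℤ)]) (m : ℤ) :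
    refl k a b m = if m ≡ a [ZMOD ((k + 1 : ℕ) : ℤ)] then m + (b - a)
      else if m ≡ b [ZMOD ((k + 1 : ℕ) : ℤ)] then m - (b - a) else m := by
  rw [refl, dif_neg h]
  rfl

theorem refl_apply_right (k : ℕ) (a b : ℤ) (h : ¬ a ≡ b [ZMOD ((k + 1 : ℕ) : ℤ)]) :
    refl k a b b = a := by
  rw [refl_apply h, if_neg (fun h' => h h'.symm), if_pos (Int.ModEq.refl b)]
  ring

theorem refl_apply_of_not_modEq {k : ℕ} {a b m : ℤ} (ha : ¬ m ≡ a [ZMOD ((k + 1 : ℕ) : ℤ)])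
    (hb : ¬ m ≡ b [ZMOD ((k + 1 : ℕ) : ℤ)]) : refl k a b m = m := by
  by_cases h : a ≡ b [ZMOD ((k + 1 : ℕ) : ℤ)]
  · rw [refl_of_modEq h]; rfl
  · rw [refl_apply h, if_neg ha, if_neg hb]

theorem refl_mul_self (k : ℕ) (a b : ℤ) : refl k a b * refl k a b = 1 := by
  by_cases h : a ≡ b [ZMOD ((k + 1 : ℕ) : ℤ)]
  · rw [refl_of_modEq h, mul_one]
  · ext m
    rw [refl, dif_neg h]
    exact reflFun_involutive _ _ _ h m

theorem refl_congr {k : ℕ} {a b a' b' : ℤ} (ha : a ≡ a' [ZMOD ((k + 1 : ℕ) : ℤ)])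
    (hd : b - a = b' - a') : refl k a b = refl k a' b' := by
  have hb : b ≡ b' [ZMOD ((k + 1 : ℕ) : ℤ)] := by
    have := ha.add_right (b - a)
    rwa [add_sub_cancel, hd, add_sub_cancel] at this
  have key : ∀ {x y z : ℤ}, y ≡ z [ZMOD ((k + 1 : ℕ) : ℤ)] →
      (x ≡ y [ZMOD ((k + 1 : ℕ) : ℤ)] ↔ x ≡ z [ZMOD ((k + 1 : ℕ) : ℤ)]) :=
    fun h => ⟨fun h' => h'.trans h, fun h' => h'.trans h.symm⟩
  by_cases h : a ≡ b [ZMOD ((k + 1 : ℕ) : ℤ)]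
  · rw [refl_of_modEq h, refl_of_modEq (ha.symm.trans (h.trans hb))]
  · have h' : ¬ a' ≡ b' [ZMOD ((k + 1 : ℕ) : ℤ)] := fun h' => h (ha.trans (h'.trans hb.symm))
    ext m
    rw [refl_apply h, refl_apply h', hd]
    simp only [key ha, key hb]

theorem refl_add_mul (k : ℕ) (a b m q : ℤ) :
    refl k a b (m + q * ((k + 1 : ℕ) : ℤ)) = refl k a b m + q * ((k + 1 : ℕ) : ℤ) := by
  have hm : m + q * ((k + 1 : ℕ) : ℤ) ≡ m [ZMOD ((k + 1 : ℕ) : ℤ)] := by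
    simp [Int.ModEq]
  have key : ∀ y : ℤ, m + q * ((k + 1 : ℕ) : ℤ) ≡ y [ZMOD ((k + 1 : ℕ) : ℤ)] ↔
      m ≡ y [ZMOD ((k + 1 : ℕ) : ℤ)] :=
    fun y => ⟨fun h => hm.symm.trans h, fun h => hm.trans h⟩
  by_cases h : a ≡ b [ZMOD ((k + 1 : ℕ) : ℤ)]
  · rw [refl_of_modEq h]; rfl
  · rw [refl_apply h, refl_apply h]
    simp only [key]
    split_ifs <;> ring

theorem simplePerm_intCast (k : ℕ) (m : ℤ) :
    simplePerm k (m : ZMod (k + 1)) = refl k m (m + 1) := by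
  refine refl_congr ?_ (by ring)
  rw [← ZMod.intCast_eq_intCast_iff]
  simp

/-- The elements of the affine symmetric group commute with translation by the period. -/
theorem perm_add_mul {k : ℕ} (w : affineSym k) (m q : ℤ) :
    (w : Equiv.Perm ℤ) (m + q * ((k + 1 : ℕ) : ℤ)) =
      (w : Equiv.Perm ℤ) m + q * ((k + 1 : ℕ) : ℤ) := by
  obtain ⟨l, rfl⟩ := exists_word w
  induction l with
  | nil => simp [wordProd]
  | cons i l ih =>
    have h1 : wordProd k (i :: l) = simple k i * wordProd k l := by simp [wordProd]
    rw [h1, Subgroup.coe_mul, Equiv.Perm.mul_apply, ih]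
    exact refl_add_mul k _ _ _ q

theorem perm_modEq_iff {k : ℕ} (w : affineSym k) (a b : ℤ) :
    (w : Equiv.Perm ℤ) a ≡ (w : Equiv.Perm ℤ) b [ZMOD ((k + 1 : ℕ) : ℤ)] ↔
      a ≡ b [ZMOD ((k + 1 : ℕ) : ℤ)] := by
  rw [Int.modEq_iff_add_fac, Int.modEq_iff_add_fac]
  constructor
  · rintro ⟨t, ht⟩
    refine ⟨t, (w : Equiv.Perm ℤ).injective ?_⟩
    rw [ht, mul_comm, perm_add_mul]
  · rintro ⟨t, ht⟩
    refine ⟨t, ?_⟩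
    rw [ht, mul_comm, perm_add_mul]

/-- Conjugating `t_{a,b}` by `w` gives `t_{w(a),w(b)}`. -/
theorem perm_mul_refl {k : ℕ} (w : affineSym k) (a b : ℤ) :
    (w : Equiv.Perm ℤ) * refl k a b =
      refl k ((w : Equiv.Perm ℤ) a) ((w : Equiv.Perm ℤ) b) * (w : Equiv.Perm ℤ) := by
  by_cases h : a ≡ b [ZMOD ((k + 1 : ℕ) : ℤ)]
  · rw [refl_of_modEq h, refl_of_modEq ((perm_modEq_iff w a b).2 h), one_mul, mul_one]
  · have h' := mt (perm_modEq_iff w a b).1 h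
    ext m
    rw [Equiv.Perm.mul_apply, Equiv.Perm.mul_apply, refl_apply h, refl_apply h']
    simp only [perm_modEq_iff]
    split_ifs with h1 h2
    · obtain ⟨t, rfl⟩ := Int.modEq_iff_add_fac.1 h1.symm
      rw [mul_comm, perm_add_mul, show a + t * ((k + 1 : ℕ) : ℤ) + (b - a) =
        b + t * ((k + 1 : ℕ) : ℤ) by ring, perm_add_mul]
      ring
    · obtain ⟨t, rfl⟩ := Int.modEq_iff_add_fac.1 h2.symm
      rw [mul_comm, perm_add_mul, show b + t * ((k + 1 : ℕ) : ℤ) - (b - a) =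
        a + t * ((k + 1 : ℕ) : ℤ) by ring, perm_add_mul]
      ring
    · rfl

theorem not_modEq_of_lt_of_lt_add {k : ℕ} {a b : ℤ} (h1 : a < b)
    (h2 : b < a + ((k + 1 : ℕ) : ℤ)) : ¬ a ≡ b [ZMOD ((k + 1 : ℕ) : ℤ)] := by
  intro h
  have := Int.eq_zero_of_dvd_of_nonneg_of_lt (by omega) (by omega) h.dvd
  omega

theorem not_modEq_of_mem_window {k : ℕ} {c a b : ℤ} (ha : c - k ≤ a ∧ a ≤ c)
    (hb : c - k ≤ b ∧ b ≤ c) (h : a ≠ b) : ¬ a ≡ b [ZMOD ((k + 1 : ℕ) : ℤ)] := by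
  rcases lt_or_gt_of_ne h with h' | h'
  · exact not_modEq_of_lt_of_lt_add h' (by push_cast; omega)
  · exact fun h'' => not_modEq_of_lt_of_lt_add h' (by push_cast; omega) h''.symm

theorem refl_apply_of_mem_window {k : ℕ} {c a b m : ℤ} (ha : c - k ≤ a ∧ a ≤ c)
    (hb : c - k ≤ b ∧ b ≤ c) (hm : c - k ≤ m ∧ m ≤ c) (h1 : m ≠ a) (h2 : m ≠ b) :
    refl k a b m = m :=
  refl_apply_of_not_modEq (not_modEq_of_mem_window hm ha h1) (not_modEq_of_mem_window hm hb h2)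

/-- Reflections in two positions of the window `{c - k, …, c}` preserve `{m | m ≤ c}`. -/
theorem refl_apply_le_iff {k : ℕ} {c a b : ℤ} (ha : c - k ≤ a ∧ a ≤ c)
    (hb : c - k ≤ b ∧ b ≤ c) (m : ℤ) : refl k a b m ≤ c ↔ m ≤ c := by
  -- a translate of the window is below `c` exactly if it is shifted by a nonpositive amount
  have key : ∀ x q : ℤ, c - k ≤ x ∧ x ≤ c → (x + ((k + 1 : ℕ) : ℤ) * q ≤ c ↔ q ≤ 0) := by
    intro x q hx
    push_cast
    constructor <;> intro h <;> nlinarith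
  by_cases h : a ≡ b [ZMOD ((k + 1 : ℕ) : ℤ)]
  · rw [refl_of_modEq h]; rfl
  rw [refl_apply h]
  split_ifs with h1 h2
  · obtain ⟨q, rfl⟩ := Int.modEq_iff_add_fac.1 h1.symm
    rw [show a + ((k + 1 : ℕ) : ℤ) * q + (b - a) = b + ((k + 1 : ℕ) : ℤ) * q by ring,
      key a q ha, key b q hb]
  · obtain ⟨q, rfl⟩ := Int.modEq_iff_add_fac.1 h2.symm
    rw [show b + ((k + 1 : ℕ) : ℤ) * q - (b - a) = a + ((k + 1 : ℕ) : ℤ) * q by ring,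
      key a q ha, key b q hb]
  · rfl

theorem not_modEq_succ {k : ℕ} (hk : 1 ≤ k) (m : ℤ) : ¬ m ≡ m + 1 [ZMOD ((k + 1 : ℕ) : ℤ)] :=
  not_modEq_of_lt_of_lt_add (by omega) (by omega)

/-- If `p` and `p + 1` are the values of `w` at `a` and `b`, then multiplying `w` on the left by the
generator that interchanges these values amounts to interchanging the positions `a` and `b`. -/
theorem simple_mul_eq_mul_refl {k : ℕ} (w : affineSym k) {a b p : ℤ}
    (ha : (w : Equiv.Perm ℤ) a = p) (hb : (w : Equiv.Perm ℤ) b = p + 1) :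
    ((simple k (p : ZMod (k + 1)) * w : affineSym k) : Equiv.Perm ℤ) =
      (w : Equiv.Perm ℤ) * refl k a b := by
  rw [perm_mul_refl, ha, hb, ← simplePerm_intCast]
  rfl

/-- By induction on `b - a`: `t_{a,b+1}` is the conjugate of `t_{a,b}` by the generator that
interchanges `b` and `b + 1`. -/
theorem refl_mem {k : ℕ} {a b : ℤ} (h1 : a < b) (h2 : b < a + ((k + 1 : ℕ) : ℤ)) :
    refl k a b ∈ affineSym k := by
  obtain ⟨d, rfl⟩ : ∃ d : ℕ, b = a + 1 + d := ⟨(b - a - 1).toNat, by omega⟩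
  induction d with
  | zero =>
    rw [Nat.cast_zero, add_zero, ← simplePerm_intCast]
    exact Subgroup.subset_closure ⟨_, rfl⟩
  | succ d ih =>
    push_cast at h1 h2 ih ⊢
    have hmem := ih (by omega) (by omega)
    set c := a + 1 + (d : ℤ) with hc
    have hcd : a + 1 + ((d : ℤ) + 1) = c + 1 := by omega
    rw [hcd] at h2 ⊢
    let s : affineSym k := simple k (c : ZMod (k + 1))
    have hs : (s : Equiv.Perm ℤ) = refl k c (c + 1) := simplePerm_intCast k c
    have hn : ¬ c ≡ c + 1 [ZMOD ((k + 1 : ℕ) : ℤ)] :=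
      not_modEq_of_lt_of_lt_add (by omega) (by push_cast; omega)
    have ha : (s : Equiv.Perm ℤ) a = a := by
      rw [hs]
      exact refl_apply_of_not_modEq (not_modEq_of_lt_of_lt_add (by omega) (by push_cast; omega))
        (not_modEq_of_lt_of_lt_add (by omega) (by push_cast; omega))
    have hc' : (s : Equiv.Perm ℤ) c = c + 1 := by rw [hs]; exact refl_apply_left _ _ _ hn
    have h : refl k a (c + 1) = s * refl k a c * (s : Equiv.Perm ℤ)⁻¹ := by
      rw [perm_mul_refl, ha, hc', mul_inv_cancel_right]
    rw [h]
    exact mul_mem (mul_mem s.2 hmem) (inv_mem s.2)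

/-! ### Length and strong exchange -/

/-- A generator reverses the order of two integers only if they are adjacent and it interchanges
them. -/
theorem simplePerm_reverses {k : ℕ} (hk : 1 ≤ k) (i : ZMod (k + 1)) {p q : ℤ} (hpq : p < q)
    (h : simplePerm k i q < simplePerm k i p) : q = p + 1 ∧ i = (p : ZMod (k + 1)) := by
  have hp := abs_le.1 (simplePerm_displacement k i p)
  have hq := abs_le.1 (simplePerm_displacement k i q)
  have hqp : q = p + 1 := by omega
  refine ⟨hqp, ?_⟩
  subst hqp
  obtain ⟨m, rfl⟩ := ZMod.intCast_surjective i
  rw [simplePerm_intCast, refl_apply (not_modEq_succ hk m), refl_apply (not_modEq_succ hk m)] at h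
  rw [ZMod.intCast_eq_intCast_iff]
  by_contra hne
  rw [if_neg (fun h' : p ≡ m [ZMOD ((k + 1 : ℕ) : ℤ)] => hne h'.symm)] at h
  have h2 : ¬ p + 1 ≡ m + 1 [ZMOD ((k + 1 : ℕ) : ℤ)] :=
    fun h' => hne (Int.ModEq.add_right_cancel' 1 h').symm
  rw [if_neg h2] at h
  split_ifs at h <;> omega

/-- The strong exchange property: if `(i, j)` is an inversion of the product of a word, then
right multiplication by `t_{i,j}` amounts to deleting a letter of the word, namely the one at which
the values at `i` and `j` change order. -/
theorem strong_exchange {k : ℕ} (hk : 1 ≤ k) (l : List (ZMod (k + 1))) {i j : ℤ} (hij : i < j)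
    (h : (wordProd k l : Equiv.Perm ℤ) j < (wordProd k l : Equiv.Perm ℤ) i) :
    ∃ l' : List (ZMod (k + 1)), l'.length + 1 = l.length ∧
      (wordProd k l' : Equiv.Perm ℤ) = (wordProd k l : Equiv.Perm ℤ) * refl k i j := by
  induction l with
  | nil => simp [wordProd] at h; omega
  | cons a l ih =>
    have h1 : ∀ l, wordProd k (a :: l) = simple k a * wordProd k l := by simp [wordProd]
    rcases lt_trichotomy ((wordProd k l : Equiv.Perm ℤ) i) ((wordProd k l : Equiv.Perm ℤ) j)
      with h2 | h2 | h2
    · rw [h1, Subgroup.coe_mul] at h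
      obtain ⟨h3, h4⟩ := simplePerm_reverses hk a h2 h
      refine ⟨l, rfl, ?_⟩
      rw [h1, h4, simple_mul_eq_mul_refl (wordProd k l) rfl h3, mul_assoc, refl_mul_self, mul_one]
    · exact absurd ((wordProd k l : Equiv.Perm ℤ).injective h2) hij.ne
    · obtain ⟨l', hl', h3⟩ := ih h2
      refine ⟨a :: l', by simp [hl'], ?_⟩
      rw [h1, h1, Subgroup.coe_mul, h3, Subgroup.coe_mul, mul_assoc]

theorem len_mul_refl_lt {k : ℕ} (hk : 1 ≤ k) {x y : affineSym k} {i j : ℤ} (hij : i < j)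
    (hy : (y : Equiv.Perm ℤ) = (x : Equiv.Perm ℤ) * refl k i j)
    (h : (x : Equiv.Perm ℤ) j < (x : Equiv.Perm ℤ) i) : len y < len x := by
  obtain ⟨l, hl, rfl⟩ := exists_reduced_word x
  obtain ⟨l', hl', h'⟩ := strong_exchange hk l hij h
  have : wordProd k l' = y := Subtype.ext (h'.trans hy.symm)
  have := len_wordProd_le l'
  subst y
  omega

/-- A reflection that shortens `x` by exactly one interchanges the values of an inversion. -/
theorem Arrow.IsFrom.inversion {k : ℕ} (hk : 1 ≤ k) {x : affineSym k} {e : Arrow k}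
    (h : e.IsFrom x) : (x : Equiv.Perm ℤ) e.j < (x : Equiv.Perm ℤ) e.i := by
  have h1 := h.i_nonpos
  have h2 := h.j_pos
  by_contra hlt
  have hxi : (x : Equiv.Perm ℤ) e.i = (e.tgt : Equiv.Perm ℤ) e.j := by
    rw [← h.mul_refl, Equiv.Perm.mul_apply, refl_apply_left _ _ _ h.not_modEq]
  have hxj : (x : Equiv.Perm ℤ) e.j = (e.tgt : Equiv.Perm ℤ) e.i := by
    rw [← h.mul_refl, Equiv.Perm.mul_apply, refl_apply_right _ _ _ h.not_modEq]
  have hne : (x : Equiv.Perm ℤ) e.i ≠ (x : Equiv.Perm ℤ) e.j :=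
    fun h' => absurd ((x : Equiv.Perm ℤ).injective h') (by omega)
  have := len_mul_refl_lt hk (x := e.tgt) (y := x) (i := e.i) (j := e.j) (by omega)
    h.mul_refl.symm (by omega)
  have := h.len_eq
  omega

/-- If some position strictly between `i` and `j` carries a value strictly between the values of the
inversion `(i, j)`, then `x t_{i,j}` is reached from `x` by three successive length-decreasing
reflections. -/
theorem len_add_two_lt_of_between {k : ℕ} (hk : 1 ≤ k) {x y : affineSym k} {i m j : ℤ}
    (him : i < m) (hmj : m < j) (hji : j < i + ((k + 1 : ℕ) : ℤ))
    (hy : (y : Equiv.Perm ℤ) = (x : Equiv.Perm ℤ) * refl k i j)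
    (h1 : (x : Equiv.Perm ℤ) j < (x : Equiv.Perm ℤ) m)
    (h2 : (x : Equiv.Perm ℤ) m < (x : Equiv.Perm ℤ) i) : len y + 2 < len x := by
  have nim := not_modEq_of_lt_of_lt_add (k := k) him (by omega)
  have nij := not_modEq_of_lt_of_lt_add (k := k) (him.trans hmj) (by omega)
  have nmj := not_modEq_of_lt_of_lt_add (k := k) hmj (by omega)
  let t₁ : affineSym k := ⟨refl k i m, refl_mem him (by omega)⟩
  let t₂ : affineSym k := ⟨refl k i j, refl_mem (him.trans hmj) (by omega)⟩
  let t₃ : affineSym k := ⟨refl k m j, refl_mem hmj (by omega)⟩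
  -- `t_{i,m} t_{i,j} t_{m,j} = t_{i,j}`
  have ht : refl k i m * refl k i j * refl k m j = refl k i j := by
    have := perm_mul_refl t₁ i j
    change refl k i m * refl k i j = refl k (refl k i m i) (refl k i m j) * refl k i m at this
    rw [refl_apply_left _ _ _ nim, refl_apply_of_not_modEq (fun h => nij h.symm)
      (fun h => nmj h.symm)] at this
    have h3 := perm_mul_refl t₃ i m
    change refl k m j * refl k i m = refl k (refl k m j i) (refl k m j m) * refl k m j at h3
    rw [refl_apply_left _ _ _ nmj, refl_apply_of_not_modEq nim nij] at h3
    rw [this, h3, mul_assoc, refl_mul_self, mul_one]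
  have e₁ : len (x * t₁) < len x := len_mul_refl_lt hk him rfl h2
  have e₂ : len (x * t₁ * t₂) < len (x * t₁) := by
    refine len_mul_refl_lt hk (him.trans hmj) rfl ?_
    change (x : Equiv.Perm ℤ) (refl k i m j) < (x : Equiv.Perm ℤ) (refl k i m i)
    rw [refl_apply_left _ _ _ nim, refl_apply_of_not_modEq (fun h => nij h.symm)
      (fun h => nmj h.symm)]
    exact h1
  have e₃ : len (x * t₁ * t₂ * t₃) < len (x * t₁ * t₂) := by
    refine len_mul_refl_lt hk hmj rfl ?_
    change (x : Equiv.Perm ℤ) (refl k i m (refl k i j j)) <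
      (x : Equiv.Perm ℤ) (refl k i m (refl k i j m))
    rw [refl_apply_right _ _ _ nij, refl_apply_left _ _ _ nim,
      refl_apply_of_not_modEq (fun h => nim h.symm) nmj, refl_apply_right _ _ _ nim]
    exact h2
  have : y = x * t₁ * t₂ * t₃ := by
    refine Subtype.ext ?_
    rw [hy, ← ht]
    simp only [Subgroup.coe_mul, mul_assoc]
    rfl
  rw [this]
  omega

/-! ### Inversions in a window -/

/-- The inversions `(a, b)` of `w` with both positions in the window `{c - k, …, c}`. -/
noncomputable def windowInv {k : ℕ} (c : ℤ) (w : affineSym k) : Finset (ℤ × ℤ) :=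
  (Finset.Icc (c - k) c ×ˢ Finset.Icc (c - k) c).filter fun p =>
    p.1 < p.2 ∧ (w : Equiv.Perm ℤ) p.2 < (w : Equiv.Perm ℤ) p.1

theorem mem_windowInv {k : ℕ} {c : ℤ} {w : affineSym k} {p : ℤ × ℤ} :
    p ∈ windowInv c w ↔ c - k ≤ p.1 ∧ p.1 < p.2 ∧ p.2 ≤ c ∧
      (w : Equiv.Perm ℤ) p.2 < (w : Equiv.Perm ℤ) p.1 := by
  simp only [windowInv, Finset.mem_filter, Finset.mem_product, Finset.mem_Icc]
  constructor
  · rintro ⟨⟨⟨h1, h2⟩, h3, h4⟩, h5, h6⟩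
    exact ⟨h1, h5, h4, h6⟩
  · rintro ⟨h1, h2, h3, h4⟩
    exact ⟨⟨⟨h1, by omega⟩, by omega, h3⟩, h2, h4⟩

theorem card_windowInv_simple_mul_le {k : ℕ} (hk : 1 ≤ k) (c : ℤ) (i : ZMod (k + 1))
    (w : affineSym k) : (windowInv c (simple k i * w)).card ≤ (windowInv c w).card + 1 := by
  have hsub : (windowInv c (simple k i * w) \ windowInv c w).card ≤ 1 := by
    rw [Finset.card_le_one]
    -- a new inversion has adjacent values, the lower one in a fixed residue class
    have key : ∀ p ∈ windowInv c (simple k i * w) \ windowInv c w,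
        (w : Equiv.Perm ℤ) p.2 = (w : Equiv.Perm ℤ) p.1 + 1 ∧
          i = ((w : Equiv.Perm ℤ) p.1 : ZMod (k + 1)) := by
      intro p hp
      rw [Finset.mem_sdiff, mem_windowInv, mem_windowInv] at hp
      obtain ⟨⟨h1, h2, h3, h4⟩, h5⟩ := hp
      have hne : (w : Equiv.Perm ℤ) p.1 ≠ (w : Equiv.Perm ℤ) p.2 :=
        fun h' => absurd ((w : Equiv.Perm ℤ).injective h') (by omega)
      have hlt : (w : Equiv.Perm ℤ) p.1 < (w : Equiv.Perm ℤ) p.2 := by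
        by_contra h6
        exact h5 ⟨h1, h2, h3, by omega⟩
      exact simplePerm_reverses hk i hlt h4
    intro p hp q hq
    obtain ⟨p1, p2⟩ := key p hp
    obtain ⟨q1, q2⟩ := key q hq
    rw [Finset.mem_sdiff, mem_windowInv] at hp hq
    have hmod : p.1 ≡ q.1 [ZMOD ((k + 1 : ℕ) : ℤ)] := by
      rw [← perm_modEq_iff w, ← ZMod.intCast_eq_intCast_iff, ← p2, ← q2]
    have h1 : p.1 = q.1 := by
      by_contra h
      exact not_modEq_of_mem_window (c := c) (by omega) (by omega) h hmod
    have h2 : p.2 = q.2 := (w : Equiv.Perm ℤ).injective (by rw [p1, q1, h1])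
    exact Prod.ext h1 h2
  have := Finset.card_le_card_sdiff_add_card (s := windowInv c (simple k i * w))
    (t := windowInv c w)
  omega

theorem card_windowInv_le_len {k : ℕ} (hk : 1 ≤ k) (c : ℤ) (w : affineSym k) :
    (windowInv c w).card ≤ len w := by
  obtain ⟨l, hl, rfl⟩ := exists_reduced_word w
  rw [← hl]
  clear hl
  induction l with
  | nil =>
    rw [List.length_nil, Nat.le_zero, Finset.card_eq_zero, Finset.eq_empty_iff_forall_notMem]
    intro p hp
    rw [mem_windowInv] at hp
    obtain ⟨-, h1, -, h2⟩ := hp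
    simp [wordProd] at h2
    omega
  | cons i l ih =>
    have h1 : wordProd k (i :: l) = simple k i * wordProd k l := by simp [wordProd]
    have := card_windowInv_simple_mul_le hk c i (wordProd k l)
    rw [h1, List.length_cons]
    omega

/-- If no position strictly between `i` and `j` carries a value strictly between the values of `x`
at `i` and `j`, then passing from `x` to `x t_{i,j}` loses at most one inversion: an inversion
`p ≠ (i, j)` of `x` yields the inversion `t_{i,j}(p)` of `x t_{i,j}`, or `p` itself if `t_{i,j}`
reverses the order of the two positions. -/
theorem card_windowInv_le_mul_refl {k : ℕ} {c : ℤ} {x y : affineSym k} {i j : ℤ}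
    (hi : c - k ≤ i) (hij : i < j) (hj : j ≤ c)
    (hy : (y : Equiv.Perm ℤ) = (x : Equiv.Perm ℤ) * refl k i j)
    (h : ∀ m, i < m → m < j → (x : Equiv.Perm ℤ) j < (x : Equiv.Perm ℤ) m →
      ¬ (x : Equiv.Perm ℤ) m < (x : Equiv.Perm ℤ) i) :
    (windowInv c x).card ≤ (windowInv c y).card + 1 := by
  have hn : ¬ i ≡ j [ZMOD ((k + 1 : ℕ) : ℤ)] :=
    not_modEq_of_lt_of_lt_add hij (by push_cast; omega)
  set f : ℤ → ℤ := ⇑(refl k i j) with hf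
  have fi : f i = j := refl_apply_left _ _ _ hn
  have fj : f j = i := refl_apply_right _ _ _ hn
  have fm : ∀ m, c - k ≤ m → m ≤ c → m ≠ i → m ≠ j → f m = m := by
    intro m h1 h2 h3 h4
    exact refl_apply_of_mem_window (c := c) (by omega) (by omega) (by omega) h3 h4
  have ff : ∀ m, f (f m) = m := fun m => by
    have := congrArg (fun g : Equiv.Perm ℤ => g m) (refl_mul_self k i j)
    simpa using this
  have hfw : ∀ m, c - k ≤ m → m ≤ c → c - k ≤ f m ∧ f m ≤ c := by
    intro m h1 h2
    by_cases h3 : m = i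
    · rw [h3, fi]; omega
    by_cases h4 : m = j
    · rw [h4, fj]; omega
    · rw [fm m h1 h2 h3 h4]; omega
  have yx : ∀ m, (y : Equiv.Perm ℤ) m = (x : Equiv.Perm ℤ) (f m) := fun m => by
    rw [hy]; rfl
  let g : ℤ × ℤ → ℤ × ℤ := fun p => if f p.1 < f p.2 then (f p.1, f p.2) else p
  have hcard : ((windowInv c x).erase (i, j)).card ≤ (windowInv c y).card := by
    refine Finset.card_le_card_of_injOn g ?_ ?_
    · rintro ⟨a, b⟩ hp
      simp only [Finset.coe_erase, Set.mem_sdiff, Finset.mem_coe, Set.mem_singleton_iff,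
        mem_windowInv, Prod.mk.injEq] at hp
      obtain ⟨⟨h1, h2, h3, h4⟩, h5⟩ := hp
      simp only [g]
      rw [Finset.mem_coe]
      split_ifs with hlt
      · rw [mem_windowInv]
        refine ⟨(hfw a h1 (by omega)).1, hlt, (hfw b (by omega) h3).2, ?_⟩
        rw [yx, yx, ff, ff]
        exact h4
      · rw [mem_windowInv]
        refine ⟨h1, h2, h3, ?_⟩
        rw [yx, yx]
        have xlt : ∀ m, m ≠ j → ¬ (x : Equiv.Perm ℤ) j < (x : Equiv.Perm ℤ) m →
            (x : Equiv.Perm ℤ) m < (x : Equiv.Perm ℤ) j := fun m hm h' =>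
          lt_of_le_of_ne (not_lt.1 h') fun h'' => hm ((x : Equiv.Perm ℤ).injective h'')
        have xlt' : ∀ m, m ≠ i → ¬ (x : Equiv.Perm ℤ) m < (x : Equiv.Perm ℤ) i →
            (x : Equiv.Perm ℤ) i < (x : Equiv.Perm ℤ) m := fun m hm h' =>
          lt_of_le_of_ne (not_lt.1 h') fun h'' => hm ((x : Equiv.Perm ℤ).injective h'').symm
        by_cases ha : a = i
        · subst ha
          have hb : b ≠ j := fun hb => h5 ⟨rfl, hb⟩
          rw [fm b (by omega) (by omega) (by omega) hb] at hlt ⊢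
          rw [fi] at hlt ⊢
          exact xlt b hb fun h' => h b h2 (by omega) h' h4
        · by_cases ha' : a = j
          · subst ha'
            rw [fj, fm b (by omega) (by omega) (by omega) (by omega)] at hlt
            omega
          · rw [fm a (by omega) (by omega) ha ha'] at hlt ⊢
            by_cases hb : b = j
            · subst hb
              rw [fj] at hlt ⊢
              exact xlt' a ha fun h' => h a (by omega) h2 h4 h'
            · by_cases hb' : b = i
              · subst hb'
                rw [fi] at hlt
                omega
              · rw [fm b (by omega) (by omega) hb' hb] at hlt
                omega
    · rintro ⟨a, b⟩ hp ⟨a', b'⟩ hp' hg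
      simp only [Finset.coe_erase, Set.mem_sdiff, Finset.mem_coe, mem_windowInv] at hp hp'
      obtain ⟨⟨-, h1, -⟩, -⟩ := hp
      obtain ⟨⟨-, h2, -⟩, -⟩ := hp'
      simp only [g] at hg
      split_ifs at hg with h3 h4 h4
      · rw [Prod.mk.injEq] at hg ⊢
        exact ⟨by rw [← ff a, hg.1, ff], by rw [← ff b, hg.2, ff]⟩
      · rw [Prod.mk.injEq] at hg
        rw [← hg.1, ← hg.2, ff, ff] at h4
        exact absurd h1 h4
      · rw [Prod.mk.injEq] at hg
        rw [hg.1, hg.2, ff, ff] at h3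
        exact absurd h2 h3
      · exact hg
  have := Finset.pred_card_le_card_erase (s := windowInv c x) (a := (i, j))
  omega

/-! ### Reading order -/

theorem mem_reading {D : Finset (ℕ × ℕ)} {x : ℕ × ℕ} : x ∈ reading D ↔ x ∈ D := by
  simp only [reading, List.mem_map, Finset.mem_sort, Finset.mem_map_equiv]
  exact ⟨fun ⟨a, ha, hx⟩ => hx ▸ ha, fun hx => ⟨toLex x, hx, rfl⟩⟩

theorem pairwise_reading (D : Finset (ℕ × ℕ)) :
    (reading D).Pairwise fun x y => toLex y < toLex x := by
  rw [reading, List.pairwise_map]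
  exact (Finset.sortedGT_sort _).pairwise

theorem toFinset_reading (D : Finset (ℕ × ℕ)) : (reading D).toFinset = D := by
  ext x
  rw [List.mem_toFinset, mem_reading]

theorem nodup_of_pairwise_lex {L : List (ℕ × ℕ)}
    (h : L.Pairwise fun x y => toLex y < toLex x) : L.Nodup :=
  h.imp fun {_ _} hxy hxy' => (hxy' ▸ hxy).ne rfl

theorem length_reading (D : Finset (ℕ × ℕ)) : (reading D).length = D.card := by
  rw [← List.toFinset_card_of_nodup (nodup_of_pairwise_lex (pairwise_reading D)),
    toFinset_reading]

theorem reading_eq {D : Finset (ℕ × ℕ)} {L : List (ℕ × ℕ)}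
    (h : L.Pairwise fun x y => toLex y < toLex x) (hD : ∀ x, x ∈ L ↔ x ∈ D) : reading D = L := by
  refine List.Perm.eq_of_pairwise (fun a b _ _ h1 h2 => absurd h1 (lt_asymm h2))
    (pairwise_reading D) h ?_
  refine List.perm_of_nodup_nodup_toFinset_eq (nodup_of_pairwise_lex (pairwise_reading D))
    (nodup_of_pairwise_lex h) ?_
  ext x
  rw [List.mem_toFinset, List.mem_toFinset, mem_reading, hD]

theorem reading_filter (D : Finset (ℕ × ℕ)) (p : ℕ × ℕ → Prop) [DecidablePred p] :
    (reading D).filter (fun x => decide (p x)) = reading (D.filter p) := by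
  refine (reading_eq ((pairwise_reading D).filter _) fun x => ?_).symm
  simp [mem_reading]

/-- Induction on Young diagrams by removal of the first cell `x` in reading order: the last cell of
the lowest row. The rest of the diagram has `x.2` cells in the row of `x` and `x.1` cells in the
column of `x`. -/
theorem reading_induction {P : YoungDiagram → Prop} (bot : P ⊥)
    (step : ∀ (μ ν : YoungDiagram) (x : ℕ × ℕ), ν ≤ μ → x ∈ μ →
      reading μ.cells = x :: reading ν.cells → ν.rowLen x.1 = x.2 → ν.colLen x.2 = x.1 →
      (∀ r, μ.rowLen r = if r = x.1 then x.2 + 1 else ν.rowLen r) →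
      (∀ s, μ.colLen s = if s = x.2 then x.1 + 1 else ν.colLen s) → P ν → P μ)
    (μ : YoungDiagram) : P μ := by
  obtain ⟨n, hn⟩ : ∃ n, μ.cells.card = n := ⟨_, rfl⟩
  induction n generalizing μ with
  | zero =>
    have : μ = ⊥ := by
      rw [Finset.card_eq_zero] at hn
      exact YoungDiagram.ext hn
    exact this ▸ bot
  | succ n ih =>
    obtain ⟨x, L, hL⟩ : ∃ x L, reading μ.cells = x :: L := by
      refine List.exists_cons_of_length_pos ?_
      rw [length_reading]
      omega
    have hpw := pairwise_reading μ.cells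
    rw [hL, List.pairwise_cons] at hpw
    have hmem : ∀ y, y ∈ μ ↔ y = x ∨ y ∈ L := fun y => by
      rw [← YoungDiagram.mem_cells, ← mem_reading, hL, List.mem_cons]
    have hx : x ∈ μ := (hmem x).2 (Or.inl rfl)
    have hxL : x ∉ L := fun h => lt_irrefl _ (hpw.1 x h)
    have hmax : ∀ y, y ∈ μ → y ≠ x → toLex y < toLex x := fun y hy hyx =>
      hpw.1 y (((hmem y).1 hy).resolve_left hyx)
    let ν : YoungDiagram :=
      { cells := μ.cells.erase x
        isLowerSet := by
          intro y z hzy hy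
          rw [Finset.mem_coe, Finset.mem_erase] at hy ⊢
          refine ⟨?_, μ.isLowerSet hzy hy.2⟩
          rintro rfl
          exact absurd (hmax y hy.2 hy.1) (not_lt.2 (Prod.Lex.toLex_mono hzy)) }
    have hν : ∀ y, y ∈ ν ↔ y ≠ x ∧ y ∈ μ := fun y => Finset.mem_erase
    have hreading : reading ν.cells = L := by
      refine reading_eq hpw.2 fun y => ?_
      rw [YoungDiagram.mem_cells, hν, hmem]
      constructor
      · exact fun h => ⟨fun h' => hxL (h' ▸ h), Or.inr h⟩
      · exact fun h => h.2.resolve_left h.1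
    have eq_of_lt_iff : ∀ {a b : ℕ}, (∀ t, t < a ↔ t < b) → a = b := fun {a b} h =>
      le_antisymm (not_lt.1 fun h' => absurd ((h b).1 h') (lt_irrefl _))
        (not_lt.1 fun h' => absurd ((h a).2 h') (lt_irrefl _))
    have hrow : ∀ s, (x.1, s) ∈ ν ↔ s < x.2 := by
      intro s
      rw [hν]
      constructor
      · rintro ⟨h1, h2⟩
        have := hmax _ h2 h1
        rw [Prod.Lex.toLex_lt_toLex] at this
        simpa using this
      · exact fun h => ⟨fun h' => by rw [← h'] at h; exact lt_irrefl _ h,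
          μ.up_left_mem le_rfl h.le hx⟩
    have hcol : ∀ r, (r, x.2) ∈ ν ↔ r < x.1 := by
      intro r
      rw [hν]
      constructor
      · rintro ⟨h1, h2⟩
        have := hmax _ h2 h1
        rw [Prod.Lex.toLex_lt_toLex] at this
        simpa using this
      · exact fun h => ⟨fun h' => by rw [← h'] at h; exact lt_irrefl _ h,
          μ.up_left_mem h.le le_rfl hx⟩
    refine step μ ν x (fun y hy => ((hν y).1 hy).2) hx (by rw [hreading, hL]) ?_ ?_ ?_ ?_
      (ih ν ?_)
    · exact eq_of_lt_iff fun s => by rw [← YoungDiagram.mem_iff_lt_rowLen, hrow]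
    · exact eq_of_lt_iff fun r => by rw [← YoungDiagram.mem_iff_lt_colLen, hcol]
    · intro r
      refine eq_of_lt_iff fun s => ?_
      rw [← YoungDiagram.mem_iff_lt_rowLen]
      split_ifs with h
      · subst h
        by_cases hs : s = x.2
        · subst hs
          exact ⟨fun _ => Nat.lt_succ_self _, fun _ => hx⟩
        · have := hrow s
          rw [hν] at this
          have hne : (x.1, s) ≠ x := fun h' => hs (by rw [← h'])
          rw [and_iff_right hne] at this
          rw [this]
          omega
      · have hne : (r, s) ≠ x := fun h' => h (by rw [← h'])
        rw [← YoungDiagram.mem_iff_lt_rowLen, hν, and_iff_right hne]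
    · intro s
      refine eq_of_lt_iff fun r => ?_
      rw [← YoungDiagram.mem_iff_lt_colLen]
      split_ifs with h
      · subst h
        by_cases hr : r = x.1
        · subst hr
          exact ⟨fun _ => Nat.lt_succ_self _, fun _ => hx⟩
        · have := hcol r
          rw [hν] at this
          have hne : (r, x.2) ≠ x := fun h' => hr (by rw [← h'])
          rw [and_iff_right hne] at this
          rw [this]
          omega
      · have hne : (r, s) ≠ x := fun h' => h (by rw [← h'])
        rw [← YoungDiagram.mem_iff_lt_colLen, hν, and_iff_right hne]
    · rw [Finset.card_erase_of_mem hx, hn]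
      rfl

/-! ### The permutation of a diagram -/

theorem mem_kRect {k c : ℕ} {x : ℕ × ℕ} : x ∈ kRect k c ↔ x.1 + c < k + 1 ∧ x.2 < c := by
  rw [← YoungDiagram.mem_cells, kRect, Finset.mem_product, Finset.mem_range, Finset.mem_range]
  omega

/-- The value at the position `-r` of the permutation of the diagram. -/
def rowVal (lam : YoungDiagram) (r : ℕ) : ℤ := (lam.rowLen r : ℤ) - r

/-- The value at the position `s + 1` of the permutation of the diagram. -/
def colVal (lam : YoungDiagram) (s : ℕ) : ℤ := (s : ℤ) + 1 - lam.colLen s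

theorem rowVal_lt_rowVal (lam : YoungDiagram) {r r' : ℕ} (h : r < r') :
    rowVal lam r' < rowVal lam r := by
  have := lam.rowLen_anti r r' h.le
  unfold rowVal
  omega

theorem rowVal_le_rowVal (lam : YoungDiagram) {r r' : ℕ} (h : r ≤ r') :
    rowVal lam r' ≤ rowVal lam r := by
  have := lam.rowLen_anti r r' h
  unfold rowVal
  omega

theorem rowVal_lt_rowVal_iff (lam : YoungDiagram) {r r' : ℕ} :
    rowVal lam r' < rowVal lam r ↔ r < r' :=
  ⟨fun h => not_le.1 fun h' => absurd h (not_lt.2 (rowVal_le_rowVal lam h')),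
    rowVal_lt_rowVal lam⟩

theorem colVal_lt_colVal (lam : YoungDiagram) {s s' : ℕ} (h : s < s') :
    colVal lam s < colVal lam s' := by
  have := lam.colLen_anti s s' h.le
  unfold colVal
  omega

theorem colVal_lt_rowVal {lam : YoungDiagram} {r s : ℕ} (h : (r, s) ∈ lam) :
    colVal lam s < rowVal lam r := by
  have h1 := YoungDiagram.mem_iff_lt_rowLen.1 h
  have h2 := YoungDiagram.mem_iff_lt_colLen.1 h
  unfold rowVal colVal
  omega

theorem rowVal_lt_colVal {lam : YoungDiagram} {r s : ℕ} (h : (r, s) ∉ lam) :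
    rowVal lam r < colVal lam s := by
  have h1 := mt YoungDiagram.mem_iff_lt_rowLen.2 h
  have h2 := mt YoungDiagram.mem_iff_lt_colLen.2 h
  unfold rowVal colVal
  omega

/-- The reflection that interchanges the positions `-r` and `s + 1` attached to the row and the
column of the cell `(r, s)`. By convention it is `1` if `t_{-r,s+1}` does not lie in the group,
which does not occur for cells of the `k`-rectangles. -/
noncomputable def cellRefl (k : ℕ) (x : ℕ × ℕ) : affineSym k :=
  open Classical in
  if h : refl k (-(x.1 : ℤ)) ((x.2 : ℤ) + 1) ∈ affineSym k then ⟨_, h⟩ else 1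

theorem coe_cellRefl {k c : ℕ} {x : ℕ × ℕ} (hx : x ∈ kRect k c) :
    (cellRefl k x : Equiv.Perm ℤ) = refl k (-(x.1 : ℤ)) ((x.2 : ℤ) + 1) := by
  rw [mem_kRect] at hx
  rw [cellRefl, dif_pos (refl_mem (by omega) (by push_cast; omega))]

theorem cellRefl_apply_row {k c : ℕ} {x : ℕ × ℕ} (hx : x ∈ kRect k c) :
    (cellRefl k x : Equiv.Perm ℤ) (-(x.1 : ℤ)) = (x.2 : ℤ) + 1 := by
  rw [coe_cellRefl hx]
  rw [mem_kRect] at hx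
  exact refl_apply_left _ _ _ (not_modEq_of_mem_window (c := c) (by omega) (by omega) (by omega))

theorem cellRefl_apply_col {k c : ℕ} {x : ℕ × ℕ} (hx : x ∈ kRect k c) :
    (cellRefl k x : Equiv.Perm ℤ) ((x.2 : ℤ) + 1) = -(x.1 : ℤ) := by
  rw [coe_cellRefl hx]
  rw [mem_kRect] at hx
  exact refl_apply_right _ _ _ (not_modEq_of_mem_window (c := c) (by omega) (by omega) (by omega))

theorem cellRefl_apply_row_of_ne {k c : ℕ} {x : ℕ × ℕ} (hx : x ∈ kRect k c) {r : ℕ}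
    (hr : r + c < k + 1) (hne : r ≠ x.1) :
    (cellRefl k x : Equiv.Perm ℤ) (-(r : ℤ)) = -(r : ℤ) := by
  rw [coe_cellRefl hx]
  rw [mem_kRect] at hx
  exact refl_apply_of_mem_window (c := c) (by omega) (by omega) (by omega) (by omega) (by omega)

theorem cellRefl_apply_col_of_ne {k c : ℕ} {x : ℕ × ℕ} (hx : x ∈ kRect k c) {s : ℕ}
    (hs : s < c) (hne : s ≠ x.2) :
    (cellRefl k x : Equiv.Perm ℤ) ((s : ℤ) + 1) = (s : ℤ) + 1 := by
  rw [coe_cellRefl hx]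
  rw [mem_kRect] at hx
  exact refl_apply_of_mem_window (c := c) (by omega) (by omega) (by omega) (by omega) (by omega)

theorem cellRefl_apply_le_iff {k c : ℕ} {x : ℕ × ℕ} (hx : x ∈ kRect k c) (m : ℤ) :
    (cellRefl k x : Equiv.Perm ℤ) m ≤ c ↔ m ≤ c := by
  rw [coe_cellRefl hx]
  rw [mem_kRect] at hx
  exact refl_apply_le_iff (by omega) (by omega) m

theorem cellRefl_mul_self {k c : ℕ} {x : ℕ × ℕ} (hx : x ∈ kRect k c) :
    cellRefl k x * cellRefl k x = 1 := by
  refine Subtype.ext ?_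
  rw [Subgroup.coe_mul, coe_cellRefl hx, refl_mul_self]
  rfl

/-- The product of the simple generators given by the residues of a list of cells. -/
def cellProd (k : ℕ) (L : List (ℕ × ℕ)) : affineSym k := wordProd k (L.map (residue k))

theorem cellProd_cons (k : ℕ) (x : ℕ × ℕ) (L : List (ℕ × ℕ)) :
    cellProd k (x :: L) = simple k (residue k x) * cellProd k L := by
  simp [cellProd, wordProd]

/-- The permutation `w_μ` of a diagram `μ` contained in a `k`-rectangle: its values in the window,
and the fact that deleting cells of `μ` from the word amounts to multiplying `w_μ` on the right by
the reflections of these cells, in reading order. -/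
theorem cellProd_reading {k c : ℕ} (μ : YoungDiagram) (hμ : μ ≤ kRect k c) :
    (∀ r : ℕ, r + c < k + 1 →
      (cellProd k (reading μ.cells) : Equiv.Perm ℤ) (-(r : ℤ)) = rowVal μ r) ∧
    (∀ s : ℕ, s < c →
      (cellProd k (reading μ.cells) : Equiv.Perm ℤ) ((s : ℤ) + 1) = colVal μ s) ∧
    (∀ m : ℤ, (cellProd k (reading μ.cells) : Equiv.Perm ℤ) m ≤ c ↔ m ≤ c) ∧
    ∀ X : Finset (ℕ × ℕ), cellProd k ((reading μ.cells).filter fun x => decide (x ∉ X)) =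
      cellProd k (reading μ.cells) *
        (((reading μ.cells).filter fun x => decide (x ∈ X)).map (cellRefl k)).prod := by
  induction μ using reading_induction with
  | bot =>
    have h : reading (⊥ : YoungDiagram).cells = [] := by simp [reading]
    have h' : ((cellProd k [] : affineSym k) : Equiv.Perm ℤ) = 1 := by simp [cellProd, wordProd]
    have hrow : ∀ r, (⊥ : YoungDiagram).rowLen r = 0 := fun r => by
      by_contra hr
      exact YoungDiagram.notMem_bot (r, 0) (YoungDiagram.mem_iff_lt_rowLen.2 (by omega))
    have hcol : ∀ r, (⊥ : YoungDiagram).colLen r = 0 := fun r => by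
      by_contra hr
      exact YoungDiagram.notMem_bot (0, r) (YoungDiagram.mem_iff_lt_colLen.2 (by omega))
    rw [h, h']
    refine ⟨fun r _ => ?_, fun s _ => ?_, fun m => Iff.rfl, fun X => ?_⟩
    · simp [rowVal, hrow]
    · simp [colVal, hcol]
    · simp
  | step μ ν x hνμ hxμ hread hrowx hcolx hrow hcol ih =>
    obtain ⟨ihr, ihc, ihw, ihX⟩ := ih (hνμ.trans hμ)
    have hx : x ∈ kRect k c := hμ hxμ
    have hx' := mem_kRect.1 hx
    have hs : simple k (residue k x) * cellProd k (reading ν.cells) =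
        cellProd k (reading ν.cells) * cellRefl k x := by
      refine Subtype.ext ?_
      rw [Subgroup.coe_mul _ (cellProd k _) (cellRefl k x), coe_cellRefl hx]
      refine simple_mul_eq_mul_refl _ ?_ ?_
      · rw [ihr _ hx'.1, rowVal, hrowx]
      · rw [ihc _ hx'.2, colVal, hcolx]
        ring
    have hprod : cellProd k (reading μ.cells) =
        cellProd k (reading ν.cells) * cellRefl k x := by
      rw [hread, cellProd_cons, hs]
    have happ : ∀ m, (cellProd k (reading μ.cells) : Equiv.Perm ℤ) m =
        (cellProd k (reading ν.cells) : Equiv.Perm ℤ) ((cellRefl k x : Equiv.Perm ℤ) m) := by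
      intro m
      rw [hprod]
      rfl
    refine ⟨fun r hr => ?_, fun s hsc => ?_, fun m => ?_, fun X => ?_⟩
    · rw [happ, rowVal, hrow]
      split_ifs with h
      · subst h
        rw [cellRefl_apply_row hx, ihc _ hx'.2, colVal, hcolx]
        push_cast
        ring
      · rw [cellRefl_apply_row_of_ne hx hr h, ihr r hr, rowVal]
    · rw [happ, colVal, hcol]
      split_ifs with h
      · subst h
        rw [cellRefl_apply_col hx, ihr _ hx'.1, rowVal, hrowx]
        push_cast
        ring
      · rw [cellRefl_apply_col_of_ne hx hsc h, ihc s hsc, colVal]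
    · rw [happ, ihw, cellRefl_apply_le_iff hx]
    · rw [hprod, hread]
      by_cases hX : x ∈ X
      · rw [List.filter_cons_of_neg (by simpa using hX), List.filter_cons_of_pos (by simpa using hX),
          ihX, List.map_cons, List.prod_cons, mul_assoc, ← mul_assoc (cellRefl k x),
          cellRefl_mul_self hx, one_mul]
      · rw [List.filter_cons_of_pos (by simpa using hX), List.filter_cons_of_neg (by simpa using hX),
          cellProd_cons, ihX, ← mul_assoc, hs]

/-! ### States of a path with increasing labels -/

/-- The permutation `x` is reached from the permutation of `lam` by interchanging the positions
`-r` and `s + 1` for the cells `(r, s)` of `Y`, from the lowest row of `Y` to the highest one, along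
arrows of the graph. Then position `-r` keeps its initial value as long as `Y` has no cell in row `r`
or above, and position `s + 1` carries the largest of its initial value and the values coming from
the cells of `Y` in column `s`. The equality of the length with the number of inversions in the
window is carried along in order to control lengths from below. -/
structure PathState (k c : ℕ) (lam : YoungDiagram) (Y : Finset (ℕ × ℕ)) (x : affineSym k) :
    Prop where
  mem_lam : ∀ y ∈ Y, y ∈ lam
  condC2 : CondC2 lam Y
  distinctRows : DistinctRows Y
  le_iff : ∀ m : ℤ, (x : Equiv.Perm ℤ) m ≤ c ↔ m ≤ c
  row_le : ∀ r : ℕ, r + c < k + 1 → (x : Equiv.Perm ℤ) (-(r : ℤ)) ≤ rowVal lam r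
  row_eq : ∀ r : ℕ, r + c < k + 1 → (∀ y ∈ Y, r < y.1) →
    (x : Equiv.Perm ℤ) (-(r : ℤ)) = rowVal lam r
  colVal_le : ∀ s : ℕ, s < c → colVal lam s ≤ (x : Equiv.Perm ℤ) ((s : ℤ) + 1)
  rowVal_le : ∀ y ∈ Y, rowVal lam y.1 ≤ (x : Equiv.Perm ℤ) ((y.2 : ℤ) + 1)
  col_eq : ∀ s : ℕ, s < c → (x : Equiv.Perm ℤ) ((s : ℤ) + 1) = colVal lam s ∨
    ∃ y ∈ Y, y.2 = s ∧ (x : Equiv.Perm ℤ) ((s : ℤ) + 1) = rowVal lam y.1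
  card_windowInv : (windowInv c x).card = len x
  len_add : len x + Y.card = lam.cells.card

theorem pathState_empty {k c : ℕ} (hk : 1 ≤ k) {lam : YoungDiagram}
    (hlam : lam ≤ kRect k c) :
    PathState k c lam ∅ (cellProd k (reading lam.cells)) := by
  obtain ⟨hr, hs, hw, -⟩ := cellProd_reading lam hlam
  have h1 : len (cellProd k (reading lam.cells)) ≤ lam.cells.card := by
    have := len_wordProd_le ((reading lam.cells).map (residue k))
    rwa [List.length_map, length_reading] at this
  have h2 := card_windowInv_le_len hk c (cellProd k (reading lam.cells))
  -- each cell `(r, s)` provides the inversion `(-r, s + 1)`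
  have h3 : lam.cells.card ≤ (windowInv c (cellProd k (reading lam.cells))).card := by
    refine Finset.card_le_card_of_injOn (fun z => (-(z.1 : ℤ), (z.2 : ℤ) + 1)) ?_ ?_
    · intro z hz
      have hz' := mem_kRect.1 (hlam hz)
      rw [Finset.mem_coe, mem_windowInv]
      refine ⟨by simp only; omega, by simp only; omega, by simp only; omega, ?_⟩
      simp only
      rw [hr _ hz'.1, hs _ hz'.2]
      exact colVal_lt_rowVal hz
    · intro z _ z' _ h
      simp only [Prod.mk.injEq] at h
      exact Prod.ext (by omega) (by omega)
  exact
    { mem_lam := by simp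
      condC2 := by simp
      distinctRows := by simp
      le_iff := hw
      row_le := fun r h => (hr r h).le
      row_eq := fun r h _ => hr r h
      colVal_le := fun s h => (hs s h).ge
      rowVal_le := by simp
      col_eq := fun s h => Or.inl (hs s h)
      card_windowInv := by omega
      len_add := by rw [Finset.card_empty]; omega }

namespace PathState

variable {k c : ℕ} {lam : YoungDiagram} {Y : Finset (ℕ × ℕ)} {x : affineSym k}

/-- As long as only rows below row `r` have been processed, the columns of `lam` that meet row `r`
carry values below that of row `r`. -/
theorem col_lt_row (st : PathState k c lam Y x) {r s : ℕ} (hs : s < c) (hrs : (r, s) ∈ lam)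
    (hY : ∀ y ∈ Y, r < y.1) : (x : Equiv.Perm ℤ) ((s : ℤ) + 1) < rowVal lam r := by
  rcases st.col_eq s hs with h | ⟨y, hy, -, h⟩
  · rw [h]
    exact colVal_lt_rowVal hrs
  · rw [h]
    exact rowVal_lt_rowVal lam (hY y hy)

/-- Condition (C2) excludes values between those of the inversion attached to the new cell. -/
theorem not_between (st : PathState k c lam Y x) (hlam : lam ≤ kRect k c) {z : ℕ × ℕ}
    (hz : z ∈ lam) (hY : ∀ y ∈ Y, z.1 < y.1) (hC : CondC2 lam (insert z Y)) (m : ℤ)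
    (h1 : -(z.1 : ℤ) < m) (h2 : m < (z.2 : ℤ) + 1)
    (h3 : (x : Equiv.Perm ℤ) ((z.2 : ℤ) + 1) < (x : Equiv.Perm ℤ) m) :
    ¬ (x : Equiv.Perm ℤ) m < (x : Equiv.Perm ℤ) (-(z.1 : ℤ)) := by
  have hzR := mem_kRect.1 (hlam hz)
  rw [st.row_eq _ hzR.1 hY]
  rcases le_or_gt m 0 with hm | hm
  · obtain ⟨r, rfl⟩ : ∃ r : ℕ, m = -(r : ℤ) := ⟨(-m).toNat, by omega⟩
    rw [st.row_eq r (by omega) fun y hy => lt_trans (by omega) (hY y hy)]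
    exact not_lt.2 (rowVal_le_rowVal lam (by omega))
  · obtain ⟨s, rfl⟩ : ∃ s : ℕ, m = (s : ℤ) + 1 := ⟨(m - 1).toNat, by omega⟩
    exfalso
    have hcol := st.colVal_le z.2 hzR.2
    rcases st.col_eq s (by omega) with h | ⟨y, hy, rfl, h⟩
    · have := colVal_lt_colVal lam (s := s) (s' := z.2) (by omega)
      omega
    · have := rowVal_lt_colVal (hC y (Finset.mem_insert_of_mem hy) z (Finset.mem_insert_self _ _)
        (hY y hy) (by omega))
      omega

/-- Conversely, if no values lie between those of the inversion attached to the new cell, then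
(C2) persists. -/
theorem condC2_insert (st : PathState k c lam Y x) (hlam : lam ≤ kRect k c) {z : ℕ × ℕ}
    (hz : z ∈ lam) (hY : ∀ y ∈ Y, z.1 < y.1)
    (h : ∀ m, -(z.1 : ℤ) < m → m < (z.2 : ℤ) + 1 →
      (x : Equiv.Perm ℤ) ((z.2 : ℤ) + 1) < (x : Equiv.Perm ℤ) m →
      ¬ (x : Equiv.Perm ℤ) m < (x : Equiv.Perm ℤ) (-(z.1 : ℤ))) :
    CondC2 lam (insert z Y) := by
  have hzR := mem_kRect.1 (hlam hz)
  rw [st.row_eq _ hzR.1 hY] at h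
  intro y hy y' hy' h1 h2 hmem
  rw [Finset.mem_insert] at hy hy'
  rcases hy with rfl | hy
  · rcases hy' with rfl | hy'
    · exact lt_irrefl _ h1
    · exact absurd (hY y' hy') (by omega)
  rcases hy' with rfl | hy'
  · -- the column of `y` carries a value above that of row `y.1`, which exceeds the initial value
    -- of the column of `z`; so the latter column has been used, by a row above `y`
    have hlt : (x : Equiv.Perm ℤ) ((y.2 : ℤ) + 1) < rowVal lam y'.1 :=
      st.col_lt_row (by omega) (lam.up_left_mem le_rfl h2.le hz) hY
    have hle := not_lt.1 fun h' => h ((y.2 : ℤ) + 1) (by omega) (by omega) h' hlt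
    have h3 := st.rowVal_le y hy
    have h4 := colVal_lt_rowVal hmem
    rcases st.col_eq y'.2 hzR.2 with h5 | ⟨v, hv, hvs, h5⟩
    · omega
    · have hvy : v.1 ≤ y.1 := by
        by_contra hvy
        have := rowVal_lt_rowVal lam (not_le.1 hvy)
        omega
      have hne : v.1 ≠ y.1 := fun hvy' => by
        have := st.distinctRows v hv y hy hvy'
        rw [this] at hvs
        omega
      rw [← hvs] at hmem h2
      exact st.condC2 y hy v hv (lt_of_le_of_ne hvy hne) h2 hmem
  · exact st.condC2 y hy y' hy' h1 h2 hmem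

end PathState

/-- The arrow from `x` that interchanges the positions attached to the row and the column of `z`. -/
noncomputable def cellArrow {k : ℕ} (x : affineSym k) (z : ℕ × ℕ) : Arrow k :=
  ⟨x * cellRefl k z, -(z.1 : ℤ), (z.2 : ℤ) + 1⟩

theorem label_cellArrow {k c : ℕ} {x : affineSym k} {z : ℕ × ℕ} (hz : z ∈ kRect k c) :
    (cellArrow x z).label = (x : Equiv.Perm ℤ) (-(z.1 : ℤ)) := by
  change (x : Equiv.Perm ℤ) ((cellRefl k z : Equiv.Perm ℤ) ((z.2 : ℤ) + 1)) = _
  rw [cellRefl_apply_col hz]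

namespace PathState

variable {k c : ℕ} {lam : YoungDiagram} {Y : Finset (ℕ × ℕ)} {x : affineSym k}

theorem insert_cell (hk : 1 ≤ k) (st : PathState k c lam Y x) (hlam : lam ≤ kRect k c)
    {z : ℕ × ℕ} (hz : z ∈ lam) (hY : ∀ y ∈ Y, z.1 < y.1) (hC : CondC2 lam (insert z Y)) :
    (cellArrow x z).IsFrom x ∧ PathState k c lam (insert z Y) (x * cellRefl k z) := by
  have hzR := hlam hz
  have hzR' := mem_kRect.1 hzR
  have hcoe : ((x * cellRefl k z : affineSym k) : Equiv.Perm ℤ) =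
      (x : Equiv.Perm ℤ) * refl k (-(z.1 : ℤ)) ((z.2 : ℤ) + 1) := by
    rw [Subgroup.coe_mul, coe_cellRefl hzR]
  have happ : ∀ m, ((x * cellRefl k z : affineSym k) : Equiv.Perm ℤ) m =
      (x : Equiv.Perm ℤ) ((cellRefl k z : Equiv.Perm ℤ) m) := fun _ => rfl
  have hrow := st.row_eq z.1 hzR'.1 hY
  have hinv : (x : Equiv.Perm ℤ) ((z.2 : ℤ) + 1) < (x : Equiv.Perm ℤ) (-(z.1 : ℤ)) := by
    rw [hrow]
    exact st.col_lt_row hzR'.2 hz hY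
  have hlt := len_mul_refl_lt hk (by omega) hcoe hinv
  have hle := card_windowInv_le_mul_refl (c := c) (by omega) (by omega) (by omega) hcoe
    (st.not_between hlam hz hY hC)
  have hle' := card_windowInv_le_len hk c (x * cellRefl k z)
  have hcw := st.card_windowInv
  have hzY : z ∉ Y := fun h => lt_irrefl _ (hY z h)
  constructor
  · exact
      { i_nonpos := by simp only [cellArrow]; omega
        j_pos := by simp only [cellArrow]; omega
        not_modEq := not_modEq_of_mem_window (c := c) (by simp only [cellArrow]; omega)
          (by simp only [cellArrow]; omega) (by simp only [cellArrow]; omega)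
        mul_refl := by
          simp only [cellArrow]
          rw [hcoe, mul_assoc, refl_mul_self, mul_one]
        len_eq := by simp only [cellArrow]; omega }
  · exact
      { mem_lam := by
          intro y hy
          rcases Finset.mem_insert.1 hy with rfl | hy
          · exact hz
          · exact st.mem_lam y hy
        condC2 := hC
        distinctRows := by
          intro y hy y' hy' h
          rw [Finset.mem_insert] at hy hy'
          rcases hy with rfl | hy <;> rcases hy' with rfl | hy'
          · rfl
          · exact absurd (hY y' hy') (by omega)
          · exact absurd (hY y hy) (by omega)
          · exact st.distinctRows y hy y' hy' h
        le_iff := fun m => by rw [happ, st.le_iff, cellRefl_apply_le_iff hzR]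
        row_le := by
          intro r hr
          rw [happ]
          by_cases h : r = z.1
          · subst h
            rw [cellRefl_apply_row hzR]
            omega
          · rw [cellRefl_apply_row_of_ne hzR hr h]
            exact st.row_le r hr
        row_eq := by
          intro r hr h
          have hrz := h z (Finset.mem_insert_self _ _)
          rw [happ, cellRefl_apply_row_of_ne hzR hr hrz.ne]
          exact st.row_eq r hr fun y hy => h y (Finset.mem_insert_of_mem hy)
        colVal_le := by
          intro s hs
          rw [happ]
          by_cases h : s = z.2
          · subst h
            rw [cellRefl_apply_col hzR]
            have := st.colVal_le z.2 hs
            omega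
          · rw [cellRefl_apply_col_of_ne hzR hs h]
            exact st.colVal_le s hs
        rowVal_le := by
          intro y hy
          rw [happ]
          by_cases h : y.2 = z.2
          · rw [h, cellRefl_apply_col hzR, hrow]
            rcases Finset.mem_insert.1 hy with rfl | hy
            · exact le_rfl
            · exact (rowVal_lt_rowVal lam (hY y hy)).le
          · have hy' : y ∈ Y := (Finset.mem_insert.1 hy).resolve_left fun h' => h (by rw [h'])
            rw [cellRefl_apply_col_of_ne hzR (mem_kRect.1 (hlam (st.mem_lam y hy'))).2 h]
            exact st.rowVal_le y hy'
        col_eq := by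
          intro s hs
          rw [happ]
          by_cases h : s = z.2
          · subst h
            rw [cellRefl_apply_col hzR]
            exact Or.inr ⟨z, Finset.mem_insert_self _ _, rfl, hrow⟩
          · rw [cellRefl_apply_col_of_ne hzR hs h]
            rcases st.col_eq s hs with h' | ⟨y, hy, hys, h'⟩
            · exact Or.inl h'
            · exact Or.inr ⟨y, Finset.mem_insert_of_mem hy, hys, h'⟩
        card_windowInv := by omega
        len_add := by
          have := st.len_add
          rw [Finset.card_insert_of_notMem hzY]
          omega }

/-- Every arrow whose label exceeds the previous ones comes from a cell. -/
theorem exists_cell (hk : 1 ≤ k) (hc : c ≤ k) (st : PathState k c lam Y x)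
    (hlam : lam ≤ kRect k c) {e : Arrow k} (he : e.IsFrom x)
    (hlabel : ∀ y ∈ Y, rowVal lam y.1 < e.label) :
    ∃ z ∈ lam, (∀ y ∈ Y, z.1 < y.1) ∧ CondC2 lam (insert z Y) ∧ e = cellArrow x z := by
  have hinv := he.inversion hk
  have hi := he.i_nonpos
  have hj := he.j_pos
  -- `x` preserves the translates of the window, so that the inversion `(i, j)` lies in the window
  have hjc : e.j ≤ c := by
    by_contra h
    have h1 := mt (st.le_iff e.j).1 h
    have h2 := (st.le_iff e.i).2 (by omega)
    omega
  have hic : c - k ≤ e.i := by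
    by_contra h
    have h1 := st.le_iff (e.i + 1 * ((k + 1 : ℕ) : ℤ))
    have h2 := st.le_iff (e.j + 1 * ((k + 1 : ℕ) : ℤ))
    rw [perm_add_mul] at h1 h2
    push_cast at h1 h2
    have h1' := h1.2 (by omega)
    have h2' := mt h2.1 (by omega)
    omega
  obtain ⟨r, hr⟩ : ∃ r : ℕ, e.i = -(r : ℤ) := ⟨(-e.i).toNat, by omega⟩
  obtain ⟨s, hs⟩ : ∃ s : ℕ, e.j = (s : ℤ) + 1 := ⟨(e.j - 1).toNat, by omega⟩
  have hrs : (r, s) ∈ kRect k c := mem_kRect.2 ⟨by simp only; omega, by simp only; omega⟩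
  have hrs' := mem_kRect.1 hrs
  have hmul : (e.tgt : Equiv.Perm ℤ) = (x : Equiv.Perm ℤ) * refl k e.i e.j := by
    rw [← he.mul_refl, mul_assoc, refl_mul_self, mul_one]
  have hlab : e.label = (x : Equiv.Perm ℤ) (-(r : ℤ)) := by
    rw [Arrow.label, hmul, Equiv.Perm.mul_apply, refl_apply_right _ _ _ he.not_modEq, hr]
  have hY : ∀ y ∈ Y, r < y.1 := by
    intro y hy
    have h1 := hlabel y hy
    have h2 := st.row_le r hrs'.1
    exact (rowVal_lt_rowVal_iff lam).1 (by omega)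
  rw [hr, hs] at hinv
  have hmem : (r, s) ∈ lam := by
    by_contra h
    have h1 := rowVal_lt_colVal h
    have h2 := st.row_le r hrs'.1
    have h3 := st.colVal_le s hrs'.2
    omega
  refine ⟨(r, s), hmem, hY, ?_, ?_⟩
  · refine st.condC2_insert hlam hmem hY fun m h1 h2 h3 h4 => ?_
    have := len_add_two_lt_of_between hk (i := e.i) (j := e.j) (m := m) (x := x) (y := e.tgt)
      (by rw [hr]; exact h1) (by rw [hs]; exact h2) (by push_cast; omega) hmul
      (by rw [hs]; exact h3) (by rw [hr]; exact h4)
    have := he.len_eq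
    omega
  · have htgt : e.tgt = x * cellRefl k (r, s) := by
      refine Subtype.ext ?_
      rw [hmul, Subgroup.coe_mul, coe_cellRefl hrs, hr, hs]
    obtain ⟨tgt, i, j⟩ := e
    simp only at hr hs htgt
    rw [cellArrow, ← htgt, hr, hs]

end PathState

/-! ### Paths with increasing labels and sets of cells -/

/-- The path from `x` that processes the cells of a list one after the other. -/
noncomputable def cellPath {k : ℕ} : affineSym k → List (ℕ × ℕ) → List (Arrow k)
  | _, [] => []
  | x, z :: L => cellArrow x z :: cellPath (x * cellRefl k z) L

theorem length_cellPath {k : ℕ} (x : affineSym k) (L : List (ℕ × ℕ)) :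
    (cellPath x L).length = L.length := by
  induction L generalizing x with
  | nil => rfl
  | cons z L ih => simp [cellPath, ih]

theorem pathEnd_cellPath {k : ℕ} (x : affineSym k) (L : List (ℕ × ℕ)) :
    pathEnd x (cellPath x L) = x * (L.map (cellRefl k)).prod := by
  induction L generalizing x with
  | nil => simp [cellPath, pathEnd]
  | cons z L ih =>
    rw [cellPath, pathEnd, List.map_cons, List.prod_cons, ← mul_assoc]
    exact ih _

theorem cellPath_injective {k : ℕ} (x : affineSym k) : Function.Injective (cellPath x) := by
  intro L L' h
  induction L generalizing x L' with
  | nil =>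
    cases L' with
    | nil => rfl
    | cons z' L' => simp [cellPath] at h
  | cons z L ih =>
    cases L' with
    | nil => simp [cellPath] at h
    | cons z' L' =>
      simp only [cellPath, List.cons.injEq, cellArrow, Arrow.mk.injEq] at h
      obtain ⟨⟨-, h1, h2⟩, h3⟩ := h
      have hz : z = z' := Prod.ext (by omega) (by omega)
      subst hz
      rw [ih _ h3]

namespace PathState

variable {k c : ℕ} {lam : YoungDiagram} {Y : Finset (ℕ × ℕ)} {x : affineSym k}

theorem isPath_cellPath (hk : 1 ≤ k) (st : PathState k c lam Y x) (hlam : lam ≤ kRect k c)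
    {L : List (ℕ × ℕ)} (hL : L.Pairwise fun z z' => z'.1 < z.1)
    (hY : ∀ z ∈ L, ∀ y ∈ Y, z.1 < y.1) (hmem : ∀ z ∈ L, z ∈ lam)
    (hC : CondC2 lam (Y ∪ L.toFinset)) :
    IsPath x (cellPath x L) ∧ (cellPath x L).map Arrow.label = L.map (fun z => rowVal lam z.1) ∧
      PathState k c lam (Y ∪ L.toFinset) (pathEnd x (cellPath x L)) := by
  induction L generalizing Y x with
  | nil =>
    refine ⟨trivial, rfl, ?_⟩
    simpa [cellPath, pathEnd] using st
  | cons z L ih =>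
    rw [List.pairwise_cons] at hL
    have hz := hmem z List.mem_cons_self
    have hzY := hY z List.mem_cons_self
    have hunion : Y ∪ (z :: L).toFinset = insert z Y ∪ L.toFinset := by
      rw [List.toFinset_cons, Finset.union_insert, Finset.insert_union]
    rw [hunion] at hC ⊢
    obtain ⟨h1, h2⟩ := st.insert_cell hk hlam hz hzY fun y hy y' hy' =>
      hC y (Finset.mem_union_left _ hy) y' (Finset.mem_union_left _ hy')
    obtain ⟨i1, i2, i3⟩ := ih h2 hL.2
      (fun z' hz' y hy => by
        rcases Finset.mem_insert.1 hy with rfl | hy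
        · exact hL.1 z' hz'
        · exact hY z' (List.mem_cons_of_mem _ hz') y hy)
      (fun z' hz' => hmem z' (List.mem_cons_of_mem _ hz')) hC
    refine ⟨⟨h1, i1⟩, ?_, i3⟩
    rw [cellPath, List.map_cons, List.map_cons, i2, label_cellArrow (hlam hz),
      st.row_eq _ (mem_kRect.1 (hlam hz)).1 hzY]

theorem exists_cellPath (hk : 1 ≤ k) (hc : c ≤ k) (st : PathState k c lam Y x)
    (hlam : lam ≤ kRect k c) {p : List (Arrow k)} (hp : IsPath x p)
    (hinc : (p.map Arrow.label).Pairwise (· < ·))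
    (hlabel : ∀ y ∈ Y, ∀ e ∈ p, rowVal lam y.1 < e.label) :
    ∃ L : List (ℕ × ℕ), L.Pairwise (fun z z' => z'.1 < z.1) ∧ (∀ z ∈ L, ∀ y ∈ Y, z.1 < y.1) ∧
      (∀ z ∈ L, z ∈ lam) ∧ CondC2 lam (Y ∪ L.toFinset) ∧ p = cellPath x L := by
  induction p generalizing Y x with
  | nil => exact ⟨[], List.Pairwise.nil, by simp, by simp, by simpa using st.condC2, rfl⟩
  | cons e p ih =>
    obtain ⟨he, hp⟩ := hp
    rw [List.map_cons, List.pairwise_cons] at hinc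
    obtain ⟨z, hz, hzY, hC, rfl⟩ := st.exists_cell hk hc hlam he fun y hy =>
      hlabel y hy e List.mem_cons_self
    have st' := (st.insert_cell hk hlam hz hzY hC).2
    obtain ⟨L, h1, h2, h3, h4, h5⟩ := ih st' hp hinc.2 fun y hy e he' => by
      rcases Finset.mem_insert.1 hy with rfl | hy
      · have := hinc.1 e.label (List.mem_map_of_mem he')
        rwa [label_cellArrow (hlam hz), st.row_eq _ (mem_kRect.1 (hlam hz)).1 hzY] at this
      · exact hlabel y hy e (List.mem_cons_of_mem _ he')
    refine ⟨z :: L, List.pairwise_cons.2 ⟨fun z' hz' => h2 z' hz' z (Finset.mem_insert_self _ _),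
      h1⟩, ?_, ?_, ?_, ?_⟩
    · intro z' hz' y hy
      rcases List.mem_cons.1 hz' with rfl | hz'
      · exact hzY y hy
      · exact h2 z' hz' y (Finset.mem_insert_of_mem hy)
    · intro z' hz'
      rcases List.mem_cons.1 hz' with rfl | hz'
      · exact hz
      · exact h3 z' hz'
    · rwa [List.toFinset_cons, Finset.union_insert, ← Finset.insert_union]
    · rw [cellPath, h5]

end PathState

theorem exists_ascComp_cons (a : ℤ) (l : List ℤ) :
    ∃ m cs, ascComp (a :: l) = (m + 1) :: cs := by
  induction l generalizing a with
  | nil => exact ⟨0, [], rfl⟩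
  | cons b l ih =>
    obtain ⟨m, cs, h⟩ := ih b
    rw [ascComp, h]
    split_ifs
    · exact ⟨0, _, rfl⟩
    · exact ⟨m + 1, cs, rfl⟩

/-- The ascent composition is `(1, …, 1)` exactly for strictly increasing sequences. -/
theorem ascComp_eq_replicate_iff (l : List ℤ) :
    ascComp l = List.replicate l.length 1 ↔ l.Pairwise (· < ·) := by
  rw [← List.isChain_iff_pairwise]
  induction l with
  | nil => simp [ascComp]
  | cons a l ih =>
    cases l with
    | nil => simp [ascComp]
    | cons b l =>
      rw [List.isChain_cons_cons, ← ih, ascComp]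
      obtain ⟨m, cs, h⟩ := exists_ascComp_cons b l
      split_ifs with hab
      · simp [hab, List.replicate_succ]
      · rw [h]
        simp [hab, List.replicate_succ]

theorem prod_gen_eq_u (R : Type*) [CommRing R] {k : ℕ} (l : List (ZMod (k + 1)))
    (h : len (wordProd k l) = l.length) :
    (l.map (gen R)).prod = NilCoxeter.u R (wordProd k l) := by
  induction l with
  | nil => rfl
  | cons i l ih =>
    have h1 : wordProd k (i :: l) = simple k i * wordProd k l := by simp [wordProd]
    have h2 : wordProd k [i] = simple k i := by simp [wordProd]
    have h3 := len_wordProd_le [i]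
    have h4 := len_wordProd_le l
    have h5 := len_mul_le (simple k i) (wordProd k l)
    rw [h2, List.length_singleton] at h3
    rw [h1, List.length_cons] at h
    rw [List.map_cons, List.prod_cons, ih (by omega), gen, NilCoxeter.u_mul_u, if_pos (by omega),
      h1]

theorem uDiag_eq_u (R : Type*) [CommRing R] {k : ℕ} {D : Finset (ℕ × ℕ)}
    (h : len (cellProd k (reading D)) = D.card) :
    uDiag R k D = NilCoxeter.u R (cellProd k (reading D)) := by
  have := prod_gen_eq_u R ((reading D).map (residue k))
    (by rw [List.length_map, length_reading]; exact h)
  rw [List.map_map] at this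
  exact this

theorem pairwise_reading_of_distinctRows {X : Finset (ℕ × ℕ)} (h : DistinctRows X) :
    (reading X).Pairwise fun z z' => z'.1 < z.1 := by
  refine (pairwise_reading X).imp_of_mem fun {a b} ha hb hab => ?_
  rcases Prod.Lex.toLex_lt_toLex.1 hab with h' | ⟨h', h''⟩
  · exact h'
  · rw [h b (mem_reading.1 hb) a (mem_reading.1 ha) h'] at h''
    exact absurd h'' (lt_irrefl _)

/-- Processing the cells of `X` leads from `w_lam` to the permutation of `lam \ X`. -/
theorem cellProd_sdiff {k c : ℕ} {lam : YoungDiagram} (hlam : lam ≤ kRect k c)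
    {X : Finset (ℕ × ℕ)} (hX : X ⊆ lam.cells) :
    cellProd k (reading (lam.cells \ X)) =
      pathEnd (cellProd k (reading lam.cells))
        (cellPath (cellProd k (reading lam.cells)) (reading X)) := by
  have h := (cellProd_reading lam hlam).2.2.2 X
  rw [reading_filter, reading_filter, Finset.filter_mem_eq_inter, Finset.inter_eq_right.2 hX,
    Finset.filter_notMem_eq_sdiff] at h
  rw [pathEnd_cellPath, h]

end DownOp

theorem mainTheorem4 (R : Type*) [CommRing R] (k : ℕ) (hk : 1 ≤ k) (c : ℕ) (hc : c ≤ k)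
    (lam : YoungDiagram) (hlam : lam ≤ DownOp.kRect k c) (n : ℕ) :
    DownOp.down R (Composition.ones n) (DownOp.uDiag R k lam.cells) =
      ∑ X ∈ lam.cells.powersetCard n with DownOp.CondC2 lam X ∧ DownOp.DistinctRows X,
        DownOp.uDiag R k (lam.cells \ X) := by
  open DownOp in
  have st := pathState_empty hk hlam
  have hlen : len (cellProd k (reading lam.cells)) = lam.cells.card := by
    have := st.len_add
    rwa [Finset.card_empty, add_zero] at this
  rw [uDiag_eq_u R hlen, down, NilCoxeter.extend_u]
  have hpath : ∀ X, X ⊆ lam.cells → CondC2 lam X → DistinctRows X → _ := fun X hX hC hD =>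
    st.isPath_cellPath hk hlam (pairwise_reading_of_distinctRows hD) (by simp)
      (fun z hz => hX (mem_reading.1 hz)) (by rwa [toFinset_reading, Finset.empty_union])
  refine (Finset.sum_nbij (fun X => cellPath (cellProd k (reading lam.cells)) (reading X))
    ?_ ?_ ?_ ?_).symm
  · intro X hX
    simp only [Finset.mem_filter, Finset.mem_powersetCard] at hX
    obtain ⟨⟨hX, hn⟩, hC, hD⟩ := hX
    obtain ⟨h1, h2, -⟩ := hpath X hX hC hD
    have h3 : (cellPath (cellProd k (reading lam.cells)) (reading X)).length = n := by
      rw [length_cellPath, length_reading, hn]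
    rw [Set.Finite.mem_toFinset]
    refine ⟨h1, h3, ?_⟩
    rw [Composition.ones_blocks, ← h3, ← List.length_map (f := Arrow.label),
      ascComp_eq_replicate_iff, h2, List.pairwise_map]
    exact (pairwise_reading_of_distinctRows hD).imp fun h => rowVal_lt_rowVal lam h
  · intro X _ X' _ h
    have := cellPath_injective _ h
    rw [← toFinset_reading X, this, toFinset_reading]
  · intro p hp
    rw [Set.Finite.coe_toFinset] at hp
    obtain ⟨h1, h2, h3⟩ := hp
    rw [Composition.ones_blocks, ← h2, ← List.length_map (f := Arrow.label),
      ascComp_eq_replicate_iff] at h3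
    obtain ⟨L, hL, -, hmem, hC, rfl⟩ := st.exists_cellPath hk hc hlam h1 h3 (by simp)
    have hread : reading L.toFinset = L :=
      reading_eq (hL.imp fun h => Prod.Lex.toLex_lt_toLex.2 (Or.inl h)) (by simp)
    refine ⟨L.toFinset, ?_, by simp only [hread]⟩
    rw [Finset.mem_coe, Finset.mem_filter, Finset.mem_powersetCard]
    rw [length_cellPath] at h2
    rw [Finset.empty_union] at hC
    refine ⟨⟨fun z hz => hmem z (List.mem_toFinset.1 hz), ?_⟩, hC, ?_⟩
    · rw [← h2, ← length_reading, hread]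
    · have h := (st.isPath_cellPath hk hlam hL (by simp) hmem
        (by rwa [Finset.empty_union])).2.2.distinctRows
      rwa [Finset.empty_union] at h
  · intro X hX
    simp only [Finset.mem_filter, Finset.mem_powersetCard] at hX
    obtain ⟨⟨hX, hn⟩, hC, hD⟩ := hX
    obtain ⟨-, -, h⟩ := hpath X hX hC hD
    have hlen' := h.len_add
    rw [toFinset_reading, Finset.empty_union] at hlen'
    rw [← cellProd_sdiff hlam hX] at hlen' ⊢
    exact uDiag_eq_u R (by rw [Finset.card_sdiff_of_subset hX]; omega)
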